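/- Let $N\ge 1$, let $\sigma=\{\lambda_1<\dots<\lambda_N\}$ and $\hat\sigma=\{\hat\lambda_1<\dots<\hat\lambda_N\}$ be sets of real numbers, let $K\in\mathbb R$, let $n\in\{0,\dots,N-1\}$ and let $\theta>0$. Put $\{\mu_1<\dots<\mu_q\}=(\sigma\cap\hat\sigma)\setminus\{K\}$ (with $q=0$ if this set is empty), $\tilde n=\min(n,N-n-1)$, and $$\hat N(\lambda)=\frac{\prod_{j=1}^N(\lambda-\hat\lambda_j)}{\prod_{j=1}^N(\lambda-\lambda_j)},$$ regarded as a rational function in lowest terms (common factors are cancelled, so that $\hat N$ and $\hat N'$ are defined at the points of $\sigma\cap\hat\sigma$). A Jacobi matrix is a real symmetric tridiagonal $N\times N$ matrix $J$ with diagonal entries $a_0,\dots,a_{N-1}$ and off-diagonal entries $b_0,\dots,b_{N-2}<0$ (the sign convention of mass-spring systems). Its mass-spring perturbation at the site $n$ with parameters $\theta$ and $K$ is the matrix $\tilde J$ that is obtained from $J$ by replacing $a_n$ with $\tilde a_n=\theta^2(a_n+M)$, where $M=(\theta^{-2}-1)K$, and $b_{n-1}$, $b_n$ (as far as they exist) with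 $\tilde b_{n-1}=\theta b_{n-1}$, $\tilde b_n=\theta b_n$, all other entries being unchanged. Call $\theta^2$ admissible if $\theta^2=\hat N(\mu_1)$ in case $q\ge 1$, and $\theta^2\in(0,\hat N(K)]$ in case $q=0$. Then the following two statements are equivalent. (A) $\theta^2$ is admissible, and conditions I)–IV) hold: I) (Interlacing.) Let $p\in\{0,\dots,N\}$ be the number of the $\lambda_j$ that are less than $K$. There is exactly one point of $\hat\sigma$ in each of the intervals $[\lambda_j,\lambda_{j+1})$ for $1\le j\le p-1$; $(\lambda_j,\lambda_{j+1}]$ for $p+1\le j\le N-1$; $[\lambda_p,K)$ if $p\ge 1$; and $(K,\lambda_{p+1}]$ if $p<N$ and $K<\lambda_{p+1}$. II) $\theta^2\in(0,1)$ and $\hat N(\mu_1)=\dots=\hat N(\mu_q)=\theta^2$. III) If $K\notin\sigma\cup\hat\sigma$, then $q\le\tilde n$ and $\hat N(K)=\theta^2$. IV) If $K\in\sigma\cup\hat\sigma$, then $K\in\sigma\cap\hat\sigma$ and either a) $q\le\tilde n$ and $\hat N(K)>\theta^2$, or b) $q<\tilde n$, $\hat N(K)=\theta^2$ and $\hat N'(K)=0$.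 (B) $\theta<1$, and there are $N\times N$ Jacobi matrices $J$ and $\tilde J$ such that $\tilde J$ is the mass-spring perturbation of $J$ at the site $n$ with parameters $\theta$ and $K$, the spectrum of $J$ is $\sigma$, and the spectrum of $\tilde J$ is $\hat\sigma$. -/

import Mathlib

namespace JacobiInverse

/-- A real `N × N` Jacobi matrix: symmetric and tridiagonal, with negative entries next to the
diagonal (the sign convention of mass-spring systems). The rows are numbered `0, …, N - 1`. -/
structure IsJacobi {N : ℕ} (J : Matrix (Fin N) (Fin N) ℝ) : Prop where
  symm : J.IsSymm
  tridiagonal : ∀ i j : Fin N, (i : ℕ) + 1 < (j : ℕ) → J i j = 0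
  offDiag_neg : ∀ i j : Fin N, (i : ℕ) + 1 = (j : ℕ) → J i j < 0

/-- The mass-spring perturbation of a Jacobi matrix `J` at the site `n`: the diagonal entry
`a_n = J n n` becomes `θ² (a_n + M)`, the off-diagonal entries in the row and the column of `n`
(that is `b_{n-1}` and `b_n`, as far as they exist, and zeros) are multiplied by `θ`, and all the
other entries are unchanged. -/
def massSpringPerturbation {N : ℕ} (J : Matrix (Fin N) (Fin N) ℝ) (n : Fin N) (θ M : ℝ) :
    Matrix (Fin N) (Fin N) ℝ :=
  Matrix.of fun i j =>
    if i = n ∧ j = n then θ ^ 2 * (J n n + M)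
    else if i = n ∨ j = n then θ * J i j
    else J i j

/-- The finite set of the points of a (strictly increasing) list of `N` real numbers. -/
noncomputable def pointSet {N : ℕ} (l : Fin N → ℝ) : Finset ℝ :=
  Finset.univ.image l

/-- The set `{μ₁, …, μ_q} = (σ ∩ σ̂) \ {K}` of common points different from `K`. -/
noncomputable def commonPoints {N : ℕ} (l lhat : Fin N → ℝ) (K : ℝ) : Finset ℝ :=
  (pointSet l ∩ pointSet lhat) \ {K}

/-- The rational function `N̂(x) = ∏ⱼ (x - λ̂ⱼ) / ∏ⱼ (x - λⱼ)`, with the factors of the common points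
of `σ` and `σ̂` cancelled, so that it has its proper value and derivative at common points too. -/
noncomputable def Nhat {N : ℕ} (l lhat : Fin N → ℝ) (x : ℝ) : ℝ :=
  (∏ y ∈ pointSet lhat \ pointSet l, (x - y)) / ∏ y ∈ pointSet l \ pointSet lhat, (x - y)

/-- Away from the points `λⱼ`, the function `Nhat` is the quotient of the full products. -/
theorem Nhat_eq_div {N : ℕ} {l lhat : Fin N → ℝ} (hl : StrictMono l) (hlhat : StrictMono lhat)
    {x : ℝ} (hx : ∀ j, x ≠ l j) :
    Nhat l lhat x = (∏ j, (x - lhat j)) / ∏ j, (x - l j) := by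
  have e : ∀ f : Fin N → ℝ, StrictMono f → ∏ j, (x - f j) = ∏ y ∈ pointSet f, (x - y) := by
    intro f hf
    rw [pointSet, Finset.prod_image (fun a _ b _ h => hf.injective h)]
  have h1 := Finset.prod_inter_mul_prod_sdiff (pointSet lhat) (pointSet l) (fun y => x - y)
  have h2 := Finset.prod_inter_mul_prod_sdiff (pointSet l) (pointSet lhat) (fun y => x - y)
  have h3 : ∏ y ∈ pointSet l ∩ pointSet lhat, (x - y) ≠ 0 := by
    refine Finset.prod_ne_zero_iff.2 fun y hy => ?_
    obtain ⟨j, -, rfl⟩ := Finset.mem_image.1 (Finset.mem_inter.1 hy).1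
    exact sub_ne_zero.2 (hx j)
  rw [e l hl, e lhat hlhat, ← h1, ← h2, Finset.inter_comm (pointSet lhat),
    mul_div_mul_left _ _ h3, Nhat]

/-- `t` is an admissible value of the parameter `θ²`: it is `N̂(μ₁)` if there are common points other
than `K`, and otherwise it is any number in `(0, N̂(K)]`. -/
def IsThetaSq {N : ℕ} (l lhat : Fin N → ℝ) (K t : ℝ) : Prop :=
  (∀ h : (commonPoints l lhat K).Nonempty, t = Nhat l lhat ((commonPoints l lhat K).min' h)) ∧
    (commonPoints l lhat K = ∅ → t ∈ Set.Ioc 0 (Nhat l lhat K))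

/-- The interlacing condition. With `p ∈ {0, …, N}` such that exactly `λ₁, …, λ_p` are less than `K`,
there is exactly one `λ̂` in each of the intervals `[λⱼ, λⱼ₊₁)` with `1 ≤ j ≤ p - 1`,
`(λⱼ, λⱼ₊₁]` with `p + 1 ≤ j ≤ N - 1`, `[λ_p, K)` if `p ≥ 1`, and `(K, λ_{p+1}]` if `p < N` and
this interval is not empty. The code numbers the points from `0`: `λⱼ` is `l (j - 1)`. -/
def Interlace {N : ℕ} (l lhat : Fin N → ℝ) (K : ℝ) : Prop :=
  ∃ p : ℕ, p ≤ N ∧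
    (∀ i : Fin N, (i : ℕ) < p → l i < K) ∧
    (∀ i : Fin N, p ≤ (i : ℕ) → K ≤ l i) ∧
    (∀ i j : Fin N, (j : ℕ) = i + 1 → (j : ℕ) < p → ∃! k, lhat k ∈ Set.Ico (l i) (l j)) ∧
    (∀ i j : Fin N, (j : ℕ) = i + 1 → p ≤ (i : ℕ) → ∃! k, lhat k ∈ Set.Ioc (l i) (l j)) ∧
    (∀ i : Fin N, (i : ℕ) + 1 = p → ∃! k, lhat k ∈ Set.Ico (l i) K) ∧
    (∀ i : Fin N, (i : ℕ) = p → K < l i → ∃! k, lhat k ∈ Set.Ioc K (l i))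

end JacobiInverse

/-!
After subtracting `K`, the mass-spring perturbation is the congruence `J̃ - K = D (J - K) D`, where `D`
is diagonal with the entry `θ` at the site `n` and ones elsewhere. So `x - J̃` is congruent to a rank
one perturbation of `x - J`, and with `w y` the squared entry at `n` of the normalized eigenvector of
`J` for the eigenvalue `y`, the characteristic polynomials satisfy
`P̂ = θ² P + (1 - θ²) (x - K) R`, where `R / P = ∑ w y / (x - y)` (`perturbationIdentity`). The spectrum
`lhat` enters only through this identity, and everything is reduced to the question which weights `w`
occur for a Jacobi matrix with the given spectrum. The answer is `IsSiteWeight`: they are nonnegative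
with sum one, at most `min n (N - n - 1)` of them vanish, and `∑_{z ≠ y} w z / (y - z) = 0` whenever
`w y = 0`.

The conditions are necessary (`exists_isSiteWeight`) because an eigenvector that vanishes at `n` splits
into eigenvectors of the two ends of the chain. They are sufficient (`IsSiteWeight.exists_jacobi`)
because one step of the continued fraction of `P / R` (`exists_continuedFraction_step`) yields the
spectral data of the two ends together; these can be distributed to ends of the right lengths if the
points of weight zero, which belong to both ends, are not too many. Each end is then recovered from
its spectral measure by the three-term recurrence (`exists_threeTerm`), and the chain has the right
spectra because an eigenvector can be glued from the solutions on the ends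
(`exists_eigenvector_tridiag`).

It remains to translate `IsSiteWeight` into the conditions on `l` and `lhat`. By the identity, `N̂` is
`θ² + (1 - θ²) (x - K) ∑ w y / (x - y)`, which gives its values at common points and its derivative at
`K`. Interlacing means that every eigenvalue moves towards `K`, without reaching `K` or the next
eigenvalue on its way (`Slot`). For given weights this follows from sign changes of `N̂` between
consecutive poles (`IsSiteWeight.slot`); conversely it makes the weights nonnegative
(`weight_nonneg_of_slot`).
-/

namespace JacobiInverse

open Polynomial Filter Topology

/-! ### Polynomials with real roots and partial fractions -/

/-- The monic polynomial whose roots are the points of `s`, all of them simple. -/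
noncomputable def rootPoly (s : Finset ℝ) : ℝ[X] := ∏ y ∈ s, (X - C y)

/-- The numerator of the rational function `∑ α y / (x - y)` over the denominator `rootPoly s`. -/
noncomputable def residuePoly (s : Finset ℝ) (α : ℝ → ℝ) : ℝ[X] :=
  ∑ y ∈ s, C (α y) * rootPoly (s.erase y)

theorem eval_rootPoly (s : Finset ℝ) (x : ℝ) : (rootPoly s).eval x = ∏ y ∈ s, (x - y) := by
  simp [rootPoly, eval_prod]

theorem rootPoly_monic (s : Finset ℝ) : (rootPoly s).Monic :=
  monic_prod_of_monic _ _ fun y _ => monic_X_sub_C y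

theorem natDegree_rootPoly (s : Finset ℝ) : (rootPoly s).natDegree = s.card := by
  simp [rootPoly]

theorem degree_rootPoly (s : Finset ℝ) : (rootPoly s).degree = s.card := by
  rw [degree_eq_natDegree (rootPoly_monic s).ne_zero, natDegree_rootPoly]

theorem eval_rootPoly_eq_zero_iff {s : Finset ℝ} {x : ℝ} : (rootPoly s).eval x = 0 ↔ x ∈ s := by
  simp [eval_rootPoly, Finset.prod_eq_zero_iff, sub_eq_zero]

theorem rootPoly_eq_mul_erase {s : Finset ℝ} {y : ℝ} (hy : y ∈ s) :
    rootPoly s = (X - C y) * rootPoly (s.erase y) :=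
  (Finset.mul_prod_erase s (fun z => X - C z) hy).symm

theorem eval_residuePoly_of_notMem {s : Finset ℝ} (α : ℝ → ℝ) {x : ℝ} (hx : x ∉ s) :
    (residuePoly s α).eval x = (rootPoly s).eval x * ∑ y ∈ s, α y / (x - y) := by
  rw [residuePoly, eval_finsetSum, Finset.mul_sum]
  refine Finset.sum_congr rfl fun y hy => ?_
  have h : x - y ≠ 0 := sub_ne_zero.2 fun h => hx (h ▸ hy)
  rw [rootPoly_eq_mul_erase hy]
  simp only [eval_mul, eval_C, eval_sub, eval_X]
  field_simp

theorem eval_residuePoly_of_mem {s : Finset ℝ} (α : ℝ → ℝ) {y : ℝ} (hy : y ∈ s) :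
    (residuePoly s α).eval y = α y * (rootPoly (s.erase y)).eval y := by
  rw [residuePoly, eval_finsetSum, Finset.sum_eq_single y]
  · simp
  · intro z _ hz
    rw [eval_mul, eval_rootPoly_eq_zero_iff.2 (Finset.mem_erase.2 ⟨hz.symm, hy⟩), mul_zero]
  · exact fun h => absurd hy h

theorem degree_residuePoly_lt (s : Finset ℝ) (α : ℝ → ℝ) :
    (residuePoly s α).degree < s.card := by
  refine (degree_sum_le _ _).trans_lt ((Finset.sup_lt_iff ?_).2 fun y hy => ?_)
  · exact WithBot.bot_lt_coe _
  · rw [C_mul']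
    refine (degree_smul_le _ _).trans_lt ?_
    rw [degree_rootPoly, Finset.card_erase_of_mem hy]
    exact_mod_cast Nat.sub_lt (Finset.card_pos.2 ⟨y, hy⟩) one_pos

theorem coeff_residuePoly (s : Finset ℝ) (α : ℝ → ℝ) :
    (residuePoly s α).coeff (s.card - 1) = ∑ y ∈ s, α y := by
  rw [residuePoly, finsetSum_coeff]
  refine Finset.sum_congr rfl fun y hy => ?_
  rw [coeff_C_mul, ← Finset.card_erase_of_mem hy, ← natDegree_rootPoly,
    (rootPoly_monic _).coeff_natDegree, mul_one]

theorem residuePoly_monic {s : Finset ℝ} {α : ℝ → ℝ} (h1 : ∑ y ∈ s, α y = 1) :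
    (residuePoly s α).Monic ∧ (residuePoly s α).natDegree + 1 = s.card := by
  have hs : 0 < s.card := Finset.card_pos.2 (Finset.nonempty_of_sum_ne_zero (by rw [h1]; simp))
  have hc := coeff_residuePoly s α
  rw [h1] at hc
  have hd : (residuePoly s α).natDegree ≤ s.card - 1 := by
    have h0 : residuePoly s α ≠ 0 := fun h => by simp [h] at hc
    have := (natDegree_lt_iff_degree_lt h0).2 (degree_residuePoly_lt s α)
    omega
  have hm := monic_of_natDegree_le_of_coeff_eq_one _ hd hc
  refine ⟨hm, ?_⟩
  have := le_natDegree_of_ne_zero (p := residuePoly s α) (n := s.card - 1) (by rw [hc]; simp)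
  omega

/-- Partial fractions: a polynomial of degree below `#s` is determined by its values on `s`. -/
theorem eq_residuePoly {s : Finset ℝ} {f : ℝ[X]} (hf : f.degree < s.card) :
    f = residuePoly s fun y => f.eval y / (rootPoly (s.erase y)).eval y := by
  refine eq_of_degrees_lt_of_eval_finset_eq s hf (degree_residuePoly_lt _ _) fun y hy => ?_
  rw [eval_residuePoly_of_mem _ hy, div_mul_cancel₀]
  rw [Ne, eval_rootPoly_eq_zero_iff]
  exact Finset.notMem_erase y s

theorem residuePoly_smul (s : Finset ℝ) (c : ℝ) (α : ℝ → ℝ) :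
    residuePoly s (fun y => c * α y) = C c * residuePoly s α := by
  simp [residuePoly, Finset.mul_sum, mul_assoc]

theorem eval_derivative_rootPoly {s : Finset ℝ} {y : ℝ} (hy : y ∈ s) :
    (rootPoly s).derivative.eval y = (rootPoly (s.erase y)).eval y := by
  rw [rootPoly_eq_mul_erase hy]
  simp [derivative_mul]

/-- A monic polynomial that has as many roots in `s` as its degree is `rootPoly s`. -/
theorem eq_rootPoly {s : Finset ℝ} {f : ℝ[X]} (hf : f.Monic) (hd : f.natDegree = s.card)
    (h : ∀ y ∈ s, f.eval y = 0) : f = rootPoly s := by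
  refine eq_of_degree_sub_lt_of_eval_finset_eq s ?_ fun y hy => ?_
  · have h1 : f.degree = s.card := by rw [degree_eq_natDegree hf.ne_zero, hd]
    rw [← h1]
    exact degree_sub_lt_left (by rw [h1, degree_rootPoly]) hf.ne_zero
      (by rw [hf, (rootPoly_monic s).leadingCoeff])
  · rw [h y hy, eval_rootPoly_eq_zero_iff.2 hy]

/-- The numerator of `∑ α y / (x - y)` with positive `α y` has only real roots, because `∑ α y / (z - y)`
has a nonzero imaginary part at every `z` that is not real. -/
theorem residuePoly_splits {s : Finset ℝ} {α : ℝ → ℝ} (hα : ∀ y ∈ s, 0 < α y)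
    (h1 : ∑ y ∈ s, α y = 1) : (residuePoly s α).Splits := by
  have hm := (residuePoly_monic h1).1
  refine Splits.of_splits_map_of_injective (i := Complex.ofRealHom)
    Complex.ofRealHom.injective (IsAlgClosed.splits _) ?_
  intro z hz
  by_contra hzr
  have him : z.im ≠ 0 := fun h => hzr ⟨z.re, by apply Complex.ext <;> simp [h]⟩
  have hzs : ∀ y : ℝ, z - y ≠ 0 := fun y h => him (by
    have := congrArg Complex.im h
    simpa using this)
  have hev : ((residuePoly s α).map Complex.ofRealHom).eval z = 0 := (mem_roots'.1 hz).2
  have hfac : ((residuePoly s α).map Complex.ofRealHom).eval z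
      = (∏ y ∈ s, (z - (y : ℂ))) * ∑ y ∈ s, (α y : ℂ) / (z - y) := by
    rw [residuePoly, Polynomial.map_sum, eval_finsetSum, Finset.mul_sum]
    refine Finset.sum_congr rfl fun y hy => ?_
    rw [← Finset.mul_prod_erase s _ hy]
    simp only [rootPoly, Polynomial.map_mul, map_C, Polynomial.map_prod, Polynomial.map_sub, map_X,
      eval_mul, eval_C, eval_prod, eval_sub, eval_X, Complex.ofRealHom_eq_coe]
    field_simp [hzs y]
  rw [hev, zero_eq_mul] at hfac
  rcases hfac with h | h
  · obtain ⟨y, _, hy⟩ := Finset.prod_eq_zero_iff.1 h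
    exact hzs y hy
  · have h2 := congrArg Complex.im h
    rw [Complex.im_sum] at h2
    have h3 : ∀ y ∈ s, ((α y : ℂ) / (z - y)).im = -z.im * (α y / Complex.normSq (z - y)) := by
      intro y _
      simp [Complex.div_im]
      ring
    rw [Finset.sum_congr rfl h3, ← Finset.mul_sum, Complex.zero_im, mul_eq_zero] at h2
    rcases h2 with h2 | h2
    · exact him (by linarith)
    · have hs : s.Nonempty := Finset.nonempty_of_sum_ne_zero (by rw [h1]; simp)
      exact (Finset.sum_pos (fun y hy => div_pos (hα y hy) (Complex.normSq_pos.2 (hzs y))) hs).ne' h2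

/-- At a root `z` of the numerator `R` of `∑ α y / (x - y)` one has
`R' z = - P z * ∑ α y / (z - y) ^ 2`, where `P` is the denominator. -/
theorem eval_derivative_residuePoly {s : Finset ℝ} {α : ℝ → ℝ} {z : ℝ} (hz : z ∉ s)
    (h : (residuePoly s α).eval z = 0) :
    (residuePoly s α).derivative.eval z =
      -((rootPoly s).eval z * ∑ y ∈ s, α y / (z - y) ^ 2) := by
  have hzy : ∀ y ∈ s, z - y ≠ 0 := fun y hy h => hz (sub_eq_zero.1 h ▸ hy)
  have hg0 : ∑ y ∈ s, α y / (z - y) = 0 := by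
    rw [eval_residuePoly_of_notMem _ hz, mul_eq_zero] at h
    exact h.resolve_left fun h => hz (eval_rootPoly_eq_zero_iff.1 h)
  have hg : HasDerivAt (fun x => ∑ y ∈ s, α y / (x - y)) (∑ y ∈ s, -(α y / (z - y) ^ 2)) z := by
    refine HasDerivAt.fun_sum fun y hy => ?_
    have := (((hasDerivAt_id z).sub_const y).inv (hzy y hy)).const_mul (α y)
    refine (this.congr_deriv ?_).congr_of_eventuallyEq (Filter.Eventually.of_forall fun x => ?_)
    · simp; ring
    · simp [div_eq_mul_inv]
  have h2 := ((rootPoly s).hasDerivAt z).mul hg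
  have hev : (fun x => (residuePoly s α).eval x) =ᶠ[nhds z]
      fun x => (rootPoly s).eval x * ∑ y ∈ s, α y / (x - y) := by
    filter_upwards [s.finite_toSet.isClosed.isOpen_compl.mem_nhds (by simpa using hz)] with x hx
    exact eval_residuePoly_of_notMem _ (by simpa using hx)
  have h3 := ((residuePoly s α).hasDerivAt z).unique (h2.congr_of_eventuallyEq hev)
  rw [h3, hg0, Finset.sum_neg_distrib]
  ring

/-- One step of the continued fraction expansion: if `R / P = ∑ α y / (x - y)` with positive weights
of sum one, then `P / R = x - a - ∑ β z / (x - z)`, where `z` runs over the roots of `R`, which are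
real and simple, and the weights `β z` are positive. -/
theorem exists_continuedFraction_step {s : Finset ℝ} {α : ℝ → ℝ} (hα : ∀ y ∈ s, 0 < α y)
    (h1 : ∑ y ∈ s, α y = 1) :
    ∃ (t : Finset ℝ) (a : ℝ) (β : ℝ → ℝ), t.card + 1 = s.card ∧ residuePoly s α = rootPoly t ∧
      (∀ z ∈ t, 0 < β z) ∧ rootPoly s = (X - C a) * rootPoly t - residuePoly t β := by
  obtain ⟨hm, hd⟩ := residuePoly_monic h1
  have hs : s.Nonempty := Finset.nonempty_of_sum_ne_zero (by rw [h1]; simp)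
  have hns : ∀ z, (residuePoly s α).eval z = 0 → z ∉ s := fun z hz hzs => by
    rw [eval_residuePoly_of_mem _ hzs, mul_eq_zero, eval_rootPoly_eq_zero_iff] at hz
    exact hz.elim (hα z hzs).ne' (Finset.notMem_erase z s)
  have hpos : ∀ z, z ∉ s → 0 < ∑ y ∈ s, α y / (z - y) ^ 2 := fun z hz =>
    Finset.sum_pos (fun y hy => div_pos (hα y hy)
      (by have : z - y ≠ 0 := fun h => hz (sub_eq_zero.1 h ▸ hy)
          positivity)) hs
  have hsimple : ∀ z, (residuePoly s α).eval z = 0 → (residuePoly s α).derivative.eval z ≠ 0 := by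
    intro z hz
    rw [eval_derivative_residuePoly (hns z hz) hz, neg_ne_zero]
    exact mul_ne_zero (fun h => hns z hz (eval_rootPoly_eq_zero_iff.1 h)) (hpos z (hns z hz)).ne'
  have hnodup : (residuePoly s α).roots.Nodup := by
    rw [Multiset.nodup_iff_count_le_one]
    intro z
    rw [count_roots]
    by_contra! hlt
    obtain ⟨h2, h3⟩ := (one_lt_rootMultiplicity_iff_isRoot hm.ne_zero).1 hlt
    exact hsimple z h2 h3
  set t := (residuePoly s α).roots.toFinset with ht
  have hmem : ∀ z, z ∈ t ↔ (residuePoly s α).eval z = 0 := fun z => by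
    rw [ht, Multiset.mem_toFinset, mem_roots hm.ne_zero, IsRoot.def]
  have hcard : (residuePoly s α).natDegree = t.card := by
    rw [ht, Multiset.toFinset_card_of_nodup hnodup]
    exact (residuePoly_splits hα h1).natDegree_eq_card_roots
  have hR : residuePoly s α = rootPoly t := eq_rootPoly hm hcard fun y hy => (hmem y).1 hy
  -- `a` is chosen so that the two leading terms of `(X - a) R - P` cancel.
  set a := -(rootPoly s - X * rootPoly t).coeff t.card with ha
  set S := (X - C a) * rootPoly t - rootPoly s with hS
  have hct : t.card + 1 = s.card := by omega
  have hSdeg : S.degree < t.card := by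
    rw [degree_lt_iff_coeff_zero]
    intro k hk
    have e1 : (rootPoly t).coeff t.card = 1 := by
      rw [← natDegree_rootPoly]; exact (rootPoly_monic t).coeff_natDegree
    have e2 : (rootPoly s).coeff (t.card + 1) = 1 := by
      rw [hct, ← natDegree_rootPoly]; exact (rootPoly_monic s).coeff_natDegree
    rw [hS, sub_mul, coeff_sub, coeff_sub, coeff_C_mul]
    rcases hk.eq_or_lt with rfl | hk
    · rw [e1, ha, coeff_sub]; ring
    · obtain ⟨k, rfl⟩ := Nat.exists_eq_add_of_lt hk
      have e3 : ∀ m, (rootPoly t).coeff (t.card + m + 1) = 0 := fun m =>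
        coeff_eq_zero_of_natDegree_lt (by rw [natDegree_rootPoly]; omega)
      rw [coeff_X_mul, e3]
      rcases k with _ | k
      · rw [add_zero, e1, e2]; ring
      · rw [← add_assoc, e3, coeff_eq_zero_of_natDegree_lt (p := rootPoly s)]
        · ring
        · rw [natDegree_rootPoly]; omega
  refine ⟨t, a, fun z => S.eval z / (rootPoly (t.erase z)).eval z, hct, hR, fun z hz => ?_, ?_⟩
  · have h0 := (hmem z).1 hz
    have hzs := hns z h0
    have hP : (rootPoly s).eval z ≠ 0 := fun h => hzs (eval_rootPoly_eq_zero_iff.1 h)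
    have e : S.eval z = -(rootPoly s).eval z := by
      rw [hS, eval_sub, eval_mul, eval_rootPoly_eq_zero_iff.2 hz]; ring
    beta_reduce
    rw [← eval_derivative_rootPoly hz, ← hR, eval_derivative_residuePoly hzs h0, e, neg_div_neg_eq,
      div_mul_cancel_left₀ hP]
    exact inv_pos.2 (hpos z hzs)
  · rw [← eq_residuePoly hSdeg, hS]; ring

/-! ### Three-term recurrences and tridiagonal matrices -/

/-- The values at `x` of the polynomials of the three-term recurrence with coefficients `a` and `b`.
The index is shifted by one: the polynomial of degree `k` has number `k + 1`, and number `0` is the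
zero polynomial, so that `b 0` plays no role. -/
def threeTerm (a b : ℕ → ℝ) (x : ℝ) : ℕ → ℝ
  | 0 => 0
  | 1 => 1
  | k + 2 => (x - a k) * threeTerm a b x (k + 1) - b k ^ 2 * threeTerm a b x k

theorem threeTerm_congr {a b a' b' : ℕ → ℝ} (x : ℝ) {m : ℕ} (ha : ∀ k < m, a k = a' k)
    (hb : ∀ k < m, b k = b' k) : ∀ k ≤ m + 1, threeTerm a b x k = threeTerm a' b' x k
  | 0, _ => rfl
  | 1, _ => rfl
  | k + 2, hk => by
    rw [threeTerm, threeTerm, ha k (by omega), hb k (by omega),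
      threeTerm_congr x ha hb (k + 1) (by omega), threeTerm_congr x ha hb k (by omega)]

/-- Every rational function `∑ α y / (x - y)` with positive weights is, up to the factor `(b m) ^ 2`,
the quotient of two consecutive polynomials of a three-term recurrence: the solution of the inverse
spectral problem of a Jacobi matrix from the spectral measure of its last site. -/
theorem exists_threeTerm (m : ℕ) : ∀ (s : Finset ℝ) (α : ℝ → ℝ), s.card = m → (∀ y ∈ s, 0 < α y) →
    ∃ a b : ℕ → ℝ, (∀ k, b k < 0) ∧ ∀ x, threeTerm a b x (m + 1) = (rootPoly s).eval x ∧
      b m ^ 2 * threeTerm a b x m = (residuePoly s α).eval x := by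
  induction m with
  | zero =>
    intro s α hs _
    rw [Finset.card_eq_zero] at hs
    subst hs
    exact ⟨0, fun _ => -1, fun _ => by norm_num, fun x => by
      simp [threeTerm, rootPoly, residuePoly]⟩
  | succ m ih =>
    intro s α hs hα
    have hne : s.Nonempty := Finset.card_pos.1 (by omega)
    have hsum : 0 < ∑ y ∈ s, α y := Finset.sum_pos hα hne
    set c := ∑ y ∈ s, α y with hc
    obtain ⟨t, a₀, β, hcard, hR, hβ, hP⟩ := exists_continuedFraction_step (s := s)
      (α := fun y => c⁻¹ * α y) (fun y hy => mul_pos (inv_pos.2 hsum) (hα y hy))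
      (by rw [← Finset.mul_sum, ← hc, inv_mul_cancel₀ hsum.ne'])
    obtain ⟨a, b, hb, hab⟩ := ih t β (by omega) hβ
    set a' := Function.update a m a₀ with ha'
    set b' := Function.update b (m + 1) (-√c) with hb'
    have hcong : ∀ x, ∀ k ≤ m + 1, threeTerm a' b' x k = threeTerm a b x k := fun x =>
      threeTerm_congr x (fun k hk => by simp [ha', hk.ne])
        fun k hk => by simp [hb', (show k ≠ m + 1 by omega)]
    refine ⟨a', b', fun k => ?_, fun x => ?_⟩
    · rcases eq_or_ne k (m + 1) with rfl | hk
      · simpa [hb'] using hsum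
      · simpa [hb', hk] using hb k
    · obtain ⟨h1, h2⟩ := hab x
      have ea : a' m = a₀ := by simp [ha']
      have eb : b' m = b m := by simp [hb']
      have eb2 : b' (m + 1) ^ 2 = c := by simp [hb', Real.sq_sqrt hsum.le]
      constructor
      · rw [threeTerm, hcong x _ le_rfl, hcong x _ (Nat.le_succ m), ea, eb, h1, h2, hP]
        simp
      · rw [eb2, hcong x _ le_rfl, h1, ← hR, residuePoly_smul]
        simp [hsum.ne']

/-- The symmetric tridiagonal matrix with the entries `d i` on the diagonal and the entry `o i`
between the sites `i` and `i + 1`. -/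
def tridiag (N : ℕ) (d o : ℕ → ℝ) : Matrix (Fin N) (Fin N) ℝ :=
  Matrix.of fun i j => if (i : ℕ) = j then d i else if (i : ℕ) + 1 = j then o i
    else if (j : ℕ) + 1 = i then o j else 0

theorem tridiag_mulVec {N : ℕ} (d o u : ℕ → ℝ) (i : Fin N) :
    (tridiag N d o).mulVec (fun j => u j) i = (if 0 < (i : ℕ) then o (i - 1) * u (i - 1) else 0)
      + d i * u i + (if (i : ℕ) + 1 < N then o i * u (i + 1) else 0) := by
  have h : ∀ j : Fin N, tridiag N d o i j * u j =
      ((if (j : ℕ) + 1 = i then o (i - 1) * u (i - 1) else 0)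
        + (if (j : ℕ) = i then d i * u i else 0)) +
        (if (j : ℕ) = i + 1 then o i * u (i + 1) else 0) := by
    intro j
    simp only [tridiag, Matrix.of_apply]
    split_ifs with h1 h2 h3 h4 h5 <;> first | omega | skip
    all_goals simp only [add_zero, zero_add, zero_mul]
    all_goals first
      | rw [show (j : ℕ) = i by omega] | rw [show (j : ℕ) = i + 1 by omega]
      | rw [show (i : ℕ) = j + 1 by omega, Nat.add_sub_cancel]
  have key : ∀ (k : ℕ) (c : ℝ), ∑ j : Fin N, (if (j : ℕ) = k then c else 0)
      = if k < N then c else 0 := by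
    intro k c
    split_ifs with hk
    · rw [Finset.sum_eq_single (⟨k, hk⟩ : Fin N)]
      · simp
      · intro j _ hj
        rw [if_neg fun h => hj (Fin.ext h)]
      · simp
    · exact Finset.sum_eq_zero fun j _ => if_neg (by have := j.2; omega)
  rw [Matrix.mulVec, dotProduct, Finset.sum_congr rfl fun j _ => h j, Finset.sum_add_distrib,
    Finset.sum_add_distrib, key, key, if_pos i.2]
  congr 2
  split_ifs with h0
  · have := key (i - 1) (o (i - 1) * u (i - 1))
    rw [if_pos (by have := i.2; omega)] at this
    rw [← this]
    exact Finset.sum_congr rfl fun j _ => by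
      congr 1; exact propext (by omega)
  · exact Finset.sum_eq_zero fun j _ => if_neg (by omega)

/-- The solution of the difference equation of a Jacobi matrix that starts at an end of the chain:
the polynomial of degree `k`, divided by the product of the off-diagonal entries it passes. -/
noncomputable def endSolution (a b : ℕ → ℝ) (x : ℝ) (k : ℕ) : ℝ :=
  threeTerm a b x (k + 1) / ∏ j ∈ Finset.range k, b (j + 1)

theorem endSolution_zero (a b : ℕ → ℝ) (x : ℝ) : endSolution a b x 0 = 1 := by
  simp [endSolution, threeTerm]

theorem endSolution_recurrence {a b : ℕ → ℝ} (hb : ∀ k, b k ≠ 0) (x : ℝ) (k : ℕ) :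
    (if 0 < k then b k * endSolution a b x (k - 1) else 0) + a k * endSolution a b x k +
      b (k + 1) * endSolution a b x (k + 1) = x * endSolution a b x k := by
  rcases k with _ | k
  · have := hb 1
    simp [endSolution, threeTerm]
    field_simp
    ring
  · have h0 : ∏ j ∈ Finset.range k, b (j + 1) ≠ 0 := Finset.prod_ne_zero_iff.2 fun j _ => hb _
    have h1 := hb (k + 1)
    have h2 := hb (k + 2)
    simp only [endSolution, threeTerm, Finset.prod_range_succ, Nat.add_sub_cancel, Nat.succ_pos,
      if_true]
    field_simp
    ring

/-- The term of the difference equation at site `k` that comes from site `k - 1`. -/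
theorem endSolution_prev {a b : ℕ → ℝ} (hb : ∀ k, b k ≠ 0) (x : ℝ) (k : ℕ) :
    (if 0 < k then b k * endSolution a b x (k - 1) else 0) =
      b k ^ 2 * threeTerm a b x k / ∏ j ∈ Finset.range k, b (j + 1) := by
  rcases k with _ | k
  · simp [threeTerm]
  · have h0 : ∏ j ∈ Finset.range k, b (j + 1) ≠ 0 := Finset.prod_ne_zero_iff.2 fun j _ => hb _
    have h1 := hb (k + 1)
    simp only [endSolution, Finset.prod_range_succ, Nat.add_sub_cancel, Nat.succ_pos, if_true]
    field_simp

/-- The diagonal of the chain that consists of a left end with coefficients `aL`, the site `n` with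
entry `c`, and a right end with coefficients `aR`, numbered from the last site inwards. -/
def chainDiag (N n : ℕ) (aL aR : ℕ → ℝ) (c : ℝ) (i : ℕ) : ℝ :=
  if i < n then aL i else if i = n then c else aR (N - 1 - i)

/-- The off-diagonal entries of the chain; `b k` is the entry between the sites `k - 1` and `k` of
either end, where the site `n` counts as the innermost site of both. -/
def chainOff (N n : ℕ) (bL bR : ℕ → ℝ) (i : ℕ) : ℝ :=
  if i < n then bL (i + 1) else bR (N - 1 - i)

/-- A zero of the (expanded) characteristic polynomial of a chain has an eigenvector. It is glued from
the two end solutions; the two conditions at the site `n` are linear in the two scaling factors. -/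
theorem exists_eigenvector_tridiag {N n : ℕ} (hn : n < N) {aL bL aR bR : ℕ → ℝ} {c x : ℝ}
    (hbL : ∀ k, bL k ≠ 0) (hbR : ∀ k, bR k ≠ 0)
    (h : (x - c) * threeTerm aL bL x (n + 1) * threeTerm aR bR x (N - 1 - n + 1)
      - bL n ^ 2 * threeTerm aL bL x n * threeTerm aR bR x (N - 1 - n + 1)
      - threeTerm aL bL x (n + 1) * (bR (N - 1 - n) ^ 2 * threeTerm aR bR x (N - 1 - n)) = 0) :
    ∃ u : Fin N → ℝ, u ≠ 0 ∧
      (tridiag N (chainDiag N n aL aR c) (chainOff N n bL bR)).mulVec u = x • u := by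
  set m := N - 1 - n with hm
  set f := endSolution aL bL x with hf
  set g := endSolution aR bR x with hg
  set f' := if 0 < n then bL n * f (n - 1) else 0 with hf'
  set g' := if 0 < m then bR m * g (m - 1) else 0 with hg'
  have hL0 : ∏ j ∈ Finset.range n, bL (j + 1) ≠ 0 := Finset.prod_ne_zero_iff.2 fun j _ => hbL _
  have hR0 : ∏ j ∈ Finset.range m, bR (j + 1) ≠ 0 := Finset.prod_ne_zero_iff.2 fun j _ => hbR _
  have hdet : f n * g' + g m * (f' + (c - x) * f n) = 0 := by
    rw [hf', hg', hf, hg, endSolution_prev hbL, endSolution_prev hbR, endSolution, endSolution]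
    field_simp
    linear_combination -h
  obtain ⟨v, hv0, hv⟩ := Matrix.exists_mulVec_eq_zero_iff.2
    (show (!![f n, -g m; f' + (c - x) * f n, g']).det = 0 by
      rw [Matrix.det_fin_two_of]; linear_combination hdet)
  have e1 : f n * v 0 - g m * v 1 = 0 := by
    have := congrFun hv 0
    simp [Matrix.mulVec, dotProduct, Fin.sum_univ_two] at this
    linarith
  have e2 : (f' + (c - x) * f n) * v 0 + g' * v 1 = 0 := by
    have := congrFun hv 1
    simpa [Matrix.mulVec, dotProduct, Fin.sum_univ_two] using this
  set u : ℕ → ℝ := fun i => if i ≤ n then v 0 * f i else v 1 * g (N - 1 - i) with hu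
  have uL : ∀ i ≤ n, u i = v 0 * f i := fun i hi => if_pos hi
  have uR : ∀ i, n ≤ i → u i = v 1 * g (N - 1 - i) := fun i hi => by
    rcases hi.eq_or_lt with rfl | hi
    · rw [uL n le_rfl, ← hm]; linarith
    · exact if_neg (by omega)
  refine ⟨fun j => u j, fun h0 => hv0 ?_, ?_⟩
  · have h0L := congrFun h0 ⟨0, by omega⟩
    have h0R := congrFun h0 ⟨N - 1, by omega⟩
    simp only [Pi.zero_apply] at h0L h0R
    rw [uL 0 (by omega), hf, endSolution_zero, mul_one] at h0L
    rw [uR (N - 1) (by omega), Nat.sub_self, hg, endSolution_zero, mul_one] at h0R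
    ext k
    fin_cases k
    · exact h0L
    · exact h0R
  · ext i
    rw [tridiag_mulVec, Pi.smul_apply, smul_eq_mul]
    obtain ⟨i, hi⟩ := i
    simp only
    rcases lt_trichotomy i n with hin | rfl | hin
    · have hrec := endSolution_recurrence (a := aL) hbL x i
      rw [uL i hin.le, uL (i - 1) (by omega), uL (i + 1) (by omega),
        if_pos (show i + 1 < N by omega), chainDiag, if_pos hin]
      have ho : chainOff N n bL bR i = bL (i + 1) := if_pos hin
      have ho' : 0 < i → chainOff N n bL bR (i - 1) = bL i := fun h => by
        rw [chainOff, if_pos (by omega), Nat.sub_add_cancel h]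
      rw [ho]
      split_ifs at hrec ⊢ with h0
      · rw [ho' h0]; linear_combination v 0 * hrec
      · linear_combination v 0 * hrec
    · have ho : chainOff N i bL bR i = bR m := by rw [chainOff, if_neg (lt_irrefl i)]
      have ho' : 0 < i → chainOff N i bL bR (i - 1) = bL i := fun h => by
        rw [chainOff, if_pos (by omega), Nat.sub_add_cancel h]
      have hd : chainDiag N i aL aR c i = c := by simp [chainDiag]
      have t1 : (if 0 < i then chainOff N i bL bR (i - 1) * u (i - 1) else 0) = f' * v 0 := by
        rw [hf']
        split_ifs with h0
        · rw [ho' h0, uL _ (by omega)]; ring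
        · ring
      have t2 : (if i + 1 < N then chainOff N i bL bR i * u (i + 1) else 0) = g' * v 1 := by
        rw [hg']
        by_cases h0 : i + 1 < N
        · rw [if_pos h0, if_pos (by omega), ho, uR _ (by omega),
            show N - 1 - (i + 1) = m - 1 by omega]
          ring
        · rw [if_neg h0, if_neg (by omega)]; ring
      rw [t1, t2, hd, uL i le_rfl]
      linear_combination e2
    · obtain ⟨k, hk⟩ : ∃ k, k = N - 1 - i := ⟨_, rfl⟩
      have hrec := endSolution_recurrence (a := aR) hbR x k
      rw [uR i hin.le, uR (i - 1) (by omega), uR (i + 1) (by omega), if_pos (by omega), ← hk,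
        show N - 1 - (i - 1) = k + 1 by omega, show N - 1 - (i + 1) = k - 1 by omega]
      have hd : chainDiag N n aL aR c i = aR k := by
        rw [chainDiag, if_neg (by omega), if_neg (by omega), hk]
      have ho : chainOff N n bL bR i = bR k := by rw [chainOff, if_neg (by omega), hk]
      have ho' : chainOff N n bL bR (i - 1) = bR (k + 1) := by
        rw [chainOff, if_neg (by omega)]; congr 1; omega
      rw [hd, ho, ho']
      by_cases h0 : 0 < k
      · rw [if_pos h0] at hrec
        rw [if_pos (by omega)]; linear_combination v 1 * hrec
      · rw [if_neg h0] at hrec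
        rw [if_neg (by omega)]; linear_combination v 1 * hrec

/-! ### From site weights to Jacobi matrices -/

theorem mem_pointSet {N : ℕ} {l : Fin N → ℝ} {x : ℝ} : x ∈ pointSet l ↔ ∃ j, l j = x := by
  simp [pointSet]

theorem card_pointSet {N : ℕ} {l : Fin N → ℝ} (hl : Function.Injective l) :
    (pointSet l).card = N := by
  rw [pointSet, Finset.card_image_of_injective _ hl, Finset.card_univ, Fintype.card_fin]

/-- Two polynomials that agree outside a finite set are equal. -/
theorem eq_of_eval_eq_of_notMem {f g : ℝ[X]} (s : Finset ℝ)
    (h : ∀ x, x ∉ s → f.eval x = g.eval x) : f = g :=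
  eq_of_infinite_eval_eq f g (s.finite_toSet.infinite_compl.mono fun x hx => h x (by simpa using hx))

/-- The relation between the characteristic polynomials of a matrix and of its mass-spring
perturbation, where `∑ w y / (x - y)` is the diagonal entry of the resolvent of the unperturbed
matrix at the perturbed site. -/
abbrev PerturbationIdentity {N : ℕ} (l lhat : Fin N → ℝ) (K θ : ℝ) (w : ℝ → ℝ) : Prop :=
  rootPoly (pointSet lhat) = C (θ ^ 2) * rootPoly (pointSet l) +
    C (1 - θ ^ 2) * (X - C K) * residuePoly (pointSet l) w

/-- `w` gives the squares of the entries at the site `n` of the normalized eigenvectors of a Jacobi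
matrix with the spectrum `l` whose mass-spring perturbation at this site has the spectrum `lhat`. The
weight may vanish at `y` only if `y` is an eigenvalue of both parts into which the chain falls when
the site `n` is removed; this bounds the number of such `y` and makes the diagonal entry
`∑ w z / (x - z)` of the resolvent vanish at them. -/
structure IsSiteWeight {N : ℕ} (n : Fin N) (l lhat : Fin N → ℝ) (K θ : ℝ) (w : ℝ → ℝ) : Prop where
  nonneg : ∀ y ∈ pointSet l, 0 ≤ w y
  sum_eq_one : ∑ y ∈ pointSet l, w y = 1
  perturbed : PerturbationIdentity l lhat K θ w
  card_le : ((pointSet l).filter fun y => w y = 0).card ≤ min (n : ℕ) (N - (n : ℕ) - 1)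
  resolvent_eq_zero : ∀ y ∈ pointSet l, w y = 0 → ∑ z ∈ (pointSet l).erase y, w z / (y - z) = 0

theorem charpoly_eq_rootPoly {N : ℕ} {M : Matrix (Fin N) (Fin N) ℝ} {l : Fin N → ℝ}
    (hl : Function.Injective l) (h : ∀ j, l j ∈ spectrum ℝ M) :
    M.charpoly = rootPoly (pointSet l) := by
  refine eq_rootPoly M.charpoly_monic ?_ fun y hy => ?_
  · rw [card_pointSet hl, Matrix.charpoly_natDegree_eq_dim, Fintype.card_fin]
  · obtain ⟨j, rfl⟩ := mem_pointSet.1 hy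
    exact Matrix.mem_spectrum_iff_isRoot_charpoly.1 (h j)

theorem mem_spectrum_of_mulVec_eq {N : ℕ} {M : Matrix (Fin N) (Fin N) ℝ} {x : ℝ}
    (h : ∃ u : Fin N → ℝ, u ≠ 0 ∧ M.mulVec u = x • u) : x ∈ spectrum ℝ M := by
  obtain ⟨u, hu, hM⟩ := h
  rw [Matrix.mem_spectrum_iff_isRoot_charpoly, IsRoot.def, Matrix.eval_charpoly]
  refine Matrix.exists_mulVec_eq_zero_iff.1 ⟨u, hu, ?_⟩
  rw [Matrix.sub_mulVec, hM, Matrix.scalar_apply, ← Matrix.smul_one_eq_diagonal, Matrix.smul_mulVec,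
    Matrix.one_mulVec, sub_self]

theorem spectrum_eq_range {N : ℕ} {M : Matrix (Fin N) (Fin N) ℝ} {l : Fin N → ℝ}
    (hl : Function.Injective l) (h : ∀ j, ∃ u : Fin N → ℝ, u ≠ 0 ∧ M.mulVec u = l j • u) :
    spectrum ℝ M = Set.range l := by
  ext x
  rw [Matrix.mem_spectrum_iff_isRoot_charpoly,
    charpoly_eq_rootPoly hl fun j => mem_spectrum_of_mulVec_eq (h j), IsRoot.def,
    eval_rootPoly_eq_zero_iff, mem_pointSet, Set.mem_range]

/-- A sum `∑ c y / (x - y)` over `t` is the sum of two such sums over sets of given sizes `n` and `m`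
that have in common exactly a given subset `Z` of `t`: at the points of `Z` the weight is halved. -/
theorem exists_residuePoly_split {t Z : Finset ℝ} {n m : ℕ} {c : ℝ → ℝ} (hc : ∀ y ∈ t, 0 < c y)
    (hZ : Z ⊆ t) (hn : Z.card ≤ n) (hm : Z.card ≤ m) (ht : t.card + Z.card = n + m) :
    ∃ (A B : Finset ℝ) (γ : ℝ → ℝ), A.card = n ∧ B.card = m ∧ (∀ y ∈ A, 0 < γ y) ∧
      (∀ y ∈ B, 0 < γ y) ∧ rootPoly A * rootPoly B = rootPoly t * rootPoly Z ∧
      residuePoly A γ * rootPoly B + rootPoly A * residuePoly B γ =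
        residuePoly t c * rootPoly Z := by
  obtain ⟨A₀, hA₀, hA₀c⟩ := Finset.exists_subset_card_eq (s := t \ Z) (n := n - Z.card)
    (by rw [Finset.card_sdiff_of_subset hZ]; omega)
  have hA₀t : A₀ ⊆ t := hA₀.trans Finset.sdiff_subset
  have hdisj : Disjoint Z A₀ := (Finset.disjoint_sdiff).mono_right hA₀
  have hU : (Z ∪ A₀) ∪ (t \ A₀) = t := by
    ext y
    have := @hZ y; have := @hA₀t y
    simp only [Finset.mem_union, Finset.mem_sdiff]; tauto
  have hI : (Z ∪ A₀) ∩ (t \ A₀) = Z := by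
    ext y
    have := @hZ y; have := @Finset.disjoint_left _ Z A₀
    simp only [Finset.mem_union, Finset.mem_sdiff, Finset.mem_inter]; tauto
  have hAt : Z ∪ A₀ ⊆ t := Finset.union_subset hZ hA₀t
  have hBt : t \ A₀ ⊆ t := Finset.sdiff_subset
  set γ : ℝ → ℝ := fun y => if y ∈ Z then c y / 2 else c y with hγ
  have hγpos : ∀ y ∈ t, 0 < γ y := fun y hy => by
    have := hc y hy
    rw [hγ]; dsimp only; split_ifs <;> linarith
  have hprod : rootPoly (Z ∪ A₀) * rootPoly (t \ A₀) = rootPoly t * rootPoly Z := by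
    have := Finset.prod_union_inter (s₁ := Z ∪ A₀) (s₂ := t \ A₀) (f := fun y : ℝ => X - C y)
    rw [hU, hI] at this
    exact this.symm
  refine ⟨Z ∪ A₀, t \ A₀, γ, ?_, ?_, fun y hy => hγpos y (hAt hy), fun y hy => hγpos y (hBt hy),
    hprod, ?_⟩
  · rw [Finset.card_union_of_disjoint hdisj, hA₀c]; omega
  · rw [Finset.card_sdiff_of_subset hA₀t, hA₀c]
    have := Finset.card_le_card hA₀t
    omega
  · refine eq_of_eval_eq_of_notMem t fun x hx => ?_
    have hsum : ∑ y ∈ Z ∪ A₀, γ y / (x - y) + ∑ y ∈ t \ A₀, γ y / (x - y)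
        = ∑ y ∈ t, c y / (x - y) := by
      rw [← Finset.sum_union_inter, hU, hI, ← Finset.sum_sdiff hZ,
        ← Finset.sum_sdiff (f := fun y => c y / (x - y)) hZ, add_assoc, ← Finset.sum_add_distrib]
      congr 1
      · refine Finset.sum_congr rfl fun y hy => ?_
        rw [hγ]; simp only; rw [if_neg (Finset.mem_sdiff.1 hy).2]
      · refine Finset.sum_congr rfl fun y hy => ?_
        rw [hγ]; simp only; rw [if_pos hy]; ring
    have hp := congrArg (eval x) hprod
    simp only [eval_mul] at hp
    simp only [eval_mul, eval_add]
    rw [eval_residuePoly_of_notMem _ fun h => hx (hAt h),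
      eval_residuePoly_of_notMem _ fun h => hx (hBt h), eval_residuePoly_of_notMem _ hx, ← hsum]
    linear_combination (∑ y ∈ Z ∪ A₀, γ y / (x - y) + ∑ y ∈ t \ A₀, γ y / (x - y)) * hp

theorem isJacobi_tridiag {N : ℕ} {d o : ℕ → ℝ} (ho : ∀ k, o k < 0) :
    IsJacobi (tridiag N d o) := by
  refine ⟨?_, fun i j h => ?_, fun i j h => ?_⟩
  · ext i j
    simp only [tridiag, Matrix.transpose_apply, Matrix.of_apply]
    split_ifs with h1 h2 h3 h4 h5 h6 <;> first | omega | rfl | rw [h1]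
  · simp only [tridiag, Matrix.of_apply]
    rw [if_neg (by omega), if_neg (by omega), if_neg (by omega)]
  · simp only [tridiag, Matrix.of_apply]
    rw [if_neg (by omega), if_pos h]
    exact ho _

theorem chainOff_neg {N n : ℕ} {bL bR : ℕ → ℝ} (hL : ∀ k, bL k < 0) (hR : ∀ k, bR k < 0) (i : ℕ) :
    chainOff N n bL bR i < 0 := by
  rw [chainOff]; split_ifs
  · exact hL _
  · exact hR _

theorem massSpringPerturbation_tridiag {N : ℕ} (n : Fin N) (aL bL aR bR : ℕ → ℝ) (a θ M : ℝ) :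
    massSpringPerturbation (tridiag N (chainDiag N n aL aR a) (chainOff N n bL bR)) n θ M =
      tridiag N (chainDiag N n aL aR (θ ^ 2 * (a + M)))
        (chainOff N n (Function.update bL n (θ * bL n))
          (Function.update bR (N - 1 - n) (θ * bR (N - 1 - n)))) := by
  ext i j
  obtain ⟨n, hn⟩ := n
  obtain ⟨i, hi⟩ := i
  obtain ⟨j, hj⟩ := j
  have hoff : ∀ k, k + 1 < N → chainOff N n (Function.update bL n (θ * bL n))
      (Function.update bR (N - 1 - n) (θ * bR (N - 1 - n))) k =
      if k = n ∨ k + 1 = n then θ * chainOff N n bL bR k else chainOff N n bL bR k := by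
    intro k hk
    simp only [chainOff, Function.update_apply]
    split_ifs <;> first | omega | (congr 2; omega) | rfl
  have hdiag : ∀ k, k ≠ n → chainDiag N n aL aR (θ ^ 2 * (a + M)) k = chainDiag N n aL aR a k := by
    intro k hk
    simp only [chainDiag, if_neg hk]
  have hdn : ∀ c, chainDiag N n aL aR c n = c := fun c => by simp [chainDiag]
  simp only [massSpringPerturbation, tridiag, Matrix.of_apply, Fin.mk.injEq]
  by_cases h1 : i = j
  · subst h1
    by_cases h2 : i = n
    · subst h2; simp [hdn]
    · simp [h2, hdiag]
  · by_cases h3 : i + 1 = j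
    · subst h3
      rw [hoff i hj]
      by_cases h4 : i = n
      · subst h4; simp
      · by_cases h5 : i + 1 = n
        · subst h5; simp
        · simp [h4, h5]
    · by_cases h3' : j + 1 = i
      · subst h3'
        rw [hoff j hi]
        by_cases h4 : j = n
        · subst h4; simp [h3]
        · by_cases h5 : j + 1 = n
          · subst h5; simp [h3]
          · simp [h3, h4, h5]
      · simp [h1, h3, h3']
        omega

/-- The inverse problem: every site weight comes from a Jacobi matrix. Removing the points of weight
zero, the first step of the continued fraction gives the points `t` of the spectrum of the two ends
of the chain; the points of weight zero lie in both ends, the others are distributed so that the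
ends have the right lengths. -/
theorem IsSiteWeight.exists_jacobi {N : ℕ} {n : Fin N} {l lhat : Fin N → ℝ} {K θ : ℝ} {w : ℝ → ℝ}
    (h : IsSiteWeight n l lhat K θ w) (hl : StrictMono l) (hlhat : StrictMono lhat) (hθ : 0 < θ) :
    ∃ J Jt : Matrix (Fin N) (Fin N) ℝ, IsJacobi J ∧ IsJacobi Jt ∧
      Jt = massSpringPerturbation J n θ (((θ ^ 2)⁻¹ - 1) * K) ∧
      spectrum ℝ J = Set.range l ∧ spectrum ℝ Jt = Set.range lhat := by
  set σ := pointSet l with hσ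
  set Z := σ.filter fun y => w y = 0 with hZ
  set σ₀ := σ \ Z with hσ₀
  have hZσ : Z ⊆ σ := Finset.filter_subset _ _
  have hZ0 : ∀ y ∈ Z, w y = 0 := fun y hy => (Finset.mem_filter.1 hy).2
  have hpos : ∀ y ∈ σ₀, 0 < w y := fun y hy => by
    obtain ⟨h1, h2⟩ := Finset.mem_sdiff.1 hy
    exact (h.nonneg y h1).lt_of_ne' fun h0 => h2 (Finset.mem_filter.2 ⟨h1, h0⟩)
  have hsub : ∀ f : ℝ → ℝ, (∀ y ∈ Z, f y = 0) → ∑ y ∈ σ₀, f y = ∑ y ∈ σ, f y := fun f hf => by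
    rw [← Finset.sum_sdiff hZσ, Finset.sum_eq_zero hf, add_zero]
  obtain ⟨t, a, c, htc, hR, hc, hP⟩ := exists_continuedFraction_step hpos
    (by rw [hsub w hZ0, h.sum_eq_one])
  have hZt : Z ⊆ t := fun y hy => by
    have hy0 : y ∉ σ₀ := fun h => (Finset.mem_sdiff.1 h).2 hy
    rw [← eval_rootPoly_eq_zero_iff, ← hR, eval_residuePoly_of_notMem _ hy0,
      hsub (fun z => w z / (y - z)) fun z hz => by simp [hZ0 z hz],
      ← Finset.sum_erase σ (a := y) (by simp), h.resolvent_eq_zero y (hZσ hy) (hZ0 y hy), mul_zero]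
  have hcard : σ₀.card + Z.card = N := by
    rw [hσ₀, Finset.card_sdiff_add_card_eq_card hZσ, card_pointSet hl.injective]
  have hcle : Z.card ≤ min (n : ℕ) (N - (n : ℕ) - 1) := h.card_le
  have hnN := n.2
  obtain ⟨A, B, γ, hA, hB, hγA, hγB, hAB, hres⟩ := exists_residuePoly_split (n := n)
    (m := N - 1 - n) hc hZt (by omega) (by omega) (by omega)
  have hσfac : rootPoly σ = rootPoly σ₀ * rootPoly Z := by
    rw [rootPoly, rootPoly, rootPoly, Finset.prod_sdiff hZσ]
  have hPσ : rootPoly σ = (X - C a) * rootPoly A * rootPoly B - residuePoly A γ * rootPoly B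
      - rootPoly A * residuePoly B γ := by
    rw [hσfac, hP]
    linear_combination -(X - C a) * hAB + hres
  have hRσ : residuePoly σ w = rootPoly A * rootPoly B := by
    rw [hAB, ← hR]
    refine eq_of_eval_eq_of_notMem σ fun x hx => ?_
    rw [eval_residuePoly_of_notMem _ hx, eval_mul,
      eval_residuePoly_of_notMem _ fun h => hx (Finset.sdiff_subset h), hσfac, eval_mul,
      hsub (fun z => w z / (x - z)) fun z hz => by simp [hZ0 z hz]]
    ring
  obtain ⟨aL, bL, hbL, hL⟩ := exists_threeTerm n A γ hA hγA
  obtain ⟨aR, bR, hbR, hRt⟩ := exists_threeTerm (N - 1 - n) B γ hB hγB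
  have hneg : ∀ (b : ℕ → ℝ) (k₀ : ℕ), (∀ k, b k < 0) →
      ∀ k, Function.update b k₀ (θ * b k₀) k < 0 := fun b k₀ hb k => by
    rw [Function.update_apply]
    split_ifs
    · exact mul_neg_of_pos_of_neg hθ (hb _)
    · exact hb k
  refine ⟨tridiag N (chainDiag N n aL aR a) (chainOff N n bL bR), _,
    isJacobi_tridiag (chainOff_neg hbL hbR), ?_, rfl, ?_, ?_⟩
  · rw [massSpringPerturbation_tridiag]
    exact isJacobi_tridiag (chainOff_neg (hneg bL n hbL) (hneg bR _ hbR))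
  · refine spectrum_eq_range hl.injective fun j => exists_eigenvector_tridiag n.2
      (fun k => (hbL k).ne) (fun k => (hbR k).ne) ?_
    rw [(hL _).1, (hL _).2, (hRt _).1, (hRt _).2]
    have := congrArg (eval (l j)) hPσ
    rw [eval_rootPoly_eq_zero_iff.2 (mem_pointSet.2 ⟨j, rfl⟩)] at this
    simp only [eval_mul, eval_sub, eval_X, eval_C] at this
    linear_combination -this
  · rw [massSpringPerturbation_tridiag]
    refine spectrum_eq_range hlhat.injective fun j => exists_eigenvector_tridiag n.2
      (fun k => (hneg bL n hbL k).ne) (fun k => (hneg bR _ hbR k).ne) ?_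
    have hcong : ∀ (a b : ℕ → ℝ) (m : ℕ) (x : ℝ), ∀ k ≤ m + 1,
        threeTerm a (Function.update b m (θ * b m)) x k = threeTerm a b x k := fun a b m x =>
      threeTerm_congr x (fun _ _ => rfl) fun k hk => by simp [hk.ne]
    rw [hcong aL bL n _ _ le_rfl, hcong aL bL n _ _ (Nat.le_succ _), hcong aR bR _ _ _ le_rfl,
      hcong aR bR _ _ _ (Nat.le_succ _), Function.update_self, Function.update_self, mul_pow,
      mul_pow, mul_assoc (θ ^ 2) (bL n ^ 2), mul_assoc (θ ^ 2) (bR (N - 1 - n) ^ 2), (hL _).1, (hL _).2, (hRt _).1, (hRt _).2]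
    have h1 := congrArg (eval (lhat j)) h.perturbed
    rw [eval_rootPoly_eq_zero_iff.2 (mem_pointSet.2 ⟨j, rfl⟩), ← hσ, hPσ, hRσ] at h1
    simp only [eval_mul, eval_sub, eval_add, eval_X, eval_C] at h1
    have h2 : θ ^ 2 * (a + ((θ ^ 2)⁻¹ - 1) * K) = θ ^ 2 * a + (1 - θ ^ 2) * K := by
      field_simp
    rw [h2]
    linear_combination -h1

/-! ### From Jacobi matrices to site weights -/

theorem sum_pointSet {N : ℕ} {l : Fin N → ℝ} (hl : Function.Injective l) (f : ℝ → ℝ) :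
    ∑ y ∈ pointSet l, f y = ∑ j, f (l j) :=
  Finset.sum_image fun _ _ _ _ h => hl h

/-- The spectral theorem for a symmetric matrix whose simple eigenvalues are listed by `l`. -/
theorem exists_orthogonal_diagonalization {N : ℕ} {J : Matrix (Fin N) (Fin N) ℝ} {l : Fin N → ℝ}
    (hJ : J.IsSymm) (hl : Function.Injective l) (hs : spectrum ℝ J = Set.range l) :
    ∃ V : Matrix (Fin N) (Fin N) ℝ, V.transpose * V = 1 ∧ V * V.transpose = 1 ∧
      J * V = V * Matrix.diagonal l := by
  have hH : J.IsHermitian := by rwa [Matrix.IsHermitian, Matrix.conjTranspose_eq_transpose_of_trivial]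
  have hev : ∀ j, ∃ i, hH.eigenvalues i = l j := fun j => by
    have : l j ∈ Set.range hH.eigenvalues := by
      rw [← hH.spectrum_real_eq_range_eigenvalues, hs]; exact ⟨j, rfl⟩
    exact this
  choose e he using hev
  have hinj : Function.Injective e := fun a b h => hl (by rw [← he a, ← he b, h])
  set V : Matrix (Fin N) (Fin N) ℝ := Matrix.of fun i j => hH.eigenvectorBasis (e j) i with hV
  have h1 : V.transpose * V = 1 := by
    ext i j
    have := orthonormal_iff_ite.1 hH.eigenvectorBasis.orthonormal (e j) (e i)
    rw [Matrix.one_apply, Matrix.mul_apply]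
    simp only [PiLp.inner_apply, RCLike.inner_apply, conj_trivial, hinj.eq_iff] at this
    simp only [hV, Matrix.transpose_apply, Matrix.of_apply]
    rw [this]
    simp [eq_comm]
  refine ⟨V, h1, mul_eq_one_comm.1 h1, ?_⟩
  ext i j
  have := congrFun (hH.mulVec_eigenvectorBasis (e j)) i
  rw [Matrix.mul_diagonal, Matrix.mul_apply, hV]
  simp only [Matrix.of_apply]
  rw [he] at this
  simp only [Matrix.mulVec, dotProduct, Pi.smul_apply, smul_eq_mul] at this
  rw [this]; ring

theorem det_diagonal_add_smul_vecMulVec {N : ℕ} {d : Fin N → ℝ} (hd : ∀ j, d j ≠ 0) (c : ℝ)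
    (u : Fin N → ℝ) : (Matrix.diagonal d + c • Matrix.vecMulVec u u).det =
      (∏ j, d j) * (1 + c * ∑ j, u j ^ 2 / d j) := by
  have hu : IsUnit (Matrix.diagonal d).det := by
    rw [Matrix.det_diagonal]
    exact (Finset.prod_ne_zero_iff.2 fun j _ => hd j).isUnit
  have hdu : IsUnit d := Pi.isUnit_iff.2 fun j => (hd j).isUnit
  have h := Matrix.det_add_replicateCol_mul_replicateRow (ι := Unit) hu (c • u) u
  rw [← Matrix.vecMulVec_eq, Matrix.smul_vecMulVec] at h
  rw [h, Matrix.det_diagonal, Matrix.det_unique, Matrix.add_apply, Matrix.one_apply_eq,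
    Matrix.inv_diagonal, Matrix.mul_apply]
  simp only [Matrix.mul_diagonal, Matrix.replicateRow_apply, Matrix.replicateCol_apply, Pi.smul_apply,
    smul_eq_mul]
  rw [Finset.mul_sum]
  congr 2
  refine Finset.sum_congr rfl fun j _ => ?_
  have : Ring.inverse d j = (d j)⁻¹ := by
    have := congrFun (Ring.mul_inverse_cancel d hdu) j
    exact eq_inv_of_mul_eq_one_right this
  rw [this]; ring

/-- With `D` the diagonal matrix with the entry `θ` at `n` and ones elsewhere, the perturbation is
`K + D (J - K) D`; its characteristic polynomial is computed from the eigenvectors of `J` by the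
determinant formula for a rank one perturbation. -/
theorem perturbationIdentity {N : ℕ} {n : Fin N} {J V : Matrix (Fin N) (Fin N) ℝ} {l lhat : Fin N → ℝ}
    {K θ : ℝ} {w : ℝ → ℝ} (hl : Function.Injective l) (hlhat : Function.Injective lhat) (hθ : 0 < θ)
    (h2 : V * V.transpose = 1) (h3 : J * V = V * Matrix.diagonal l)
    (hs : spectrum ℝ (massSpringPerturbation J n θ (((θ ^ 2)⁻¹ - 1) * K)) = Set.range lhat)
    (hw : ∀ j, w (l j) = V n j ^ 2) :
    PerturbationIdentity l lhat K θ w := by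
  refine eq_of_eval_eq_of_notMem (pointSet l) fun x hx => ?_
  have hxl : ∀ j, x - l j ≠ 0 := fun j h => hx (mem_pointSet.2 ⟨j, (sub_eq_zero.1 h).symm⟩)
  rw [← charpoly_eq_rootPoly hlhat fun j => by rw [hs]; exact ⟨j, rfl⟩, Matrix.eval_charpoly]
  simp only [eval_add, eval_mul, eval_C, eval_sub, eval_X]
  rw [eval_residuePoly_of_notMem _ hx, eval_rootPoly, sum_pointSet hl]
  rw [show ∏ y ∈ pointSet l, (x - y) = ∏ j, (x - l j) from
    Finset.prod_image fun _ _ _ _ h => hl h]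
  set D : Matrix (Fin N) (Fin N) ℝ := Matrix.diagonal (Function.update 1 n θ) with hD
  -- `x - J̃ = D (x - J + c e eᵀ) D` for this `c`, with `e` the unit vector of the site `n`.
  set c := (1 - θ ^ 2) * (x - K) / θ ^ 2 with hc
  have hJ : J = V * Matrix.diagonal l * V.transpose := by
    rw [← h3, mul_assoc, h2, mul_one]
  have hcol : V.mulVec (V n) = Pi.single n 1 := by
    ext i
    have := congrFun (congrFun h2 i) n
    rw [Matrix.mul_apply, Matrix.one_apply] at this
    rw [Pi.single_apply, ← this]
    rfl
  have hrow : Matrix.vecMul (V n) V.transpose = Pi.single n 1 := by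
    rw [Matrix.vecMul_transpose, hcol]
  have hmid : V * (Matrix.diagonal (fun j => x - l j) + c • Matrix.vecMulVec (V n) (V n)) *
      V.transpose = (Matrix.scalar (Fin N) x - J) +
        c • Matrix.vecMulVec (Pi.single n 1) (Pi.single n 1) := by
    rw [mul_add, add_mul]
    congr 1
    · rw [hJ, show (Matrix.diagonal fun j => x - l j) = x • 1 - Matrix.diagonal l by
        rw [Matrix.smul_one_eq_diagonal, Matrix.diagonal_sub], mul_sub, sub_mul, mul_smul_comm,
        smul_mul_assoc, mul_one, h2, Matrix.scalar_apply, Matrix.smul_one_eq_diagonal]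
    · rw [mul_smul_comm, smul_mul_assoc, Matrix.mul_vecMulVec, Matrix.vecMulVec_mul, hcol, hrow]
  have hfull : Matrix.scalar (Fin N) x - massSpringPerturbation J n θ (((θ ^ 2)⁻¹ - 1) * K) =
      D * ((Matrix.scalar (Fin N) x - J) +
        c • Matrix.vecMulVec (Pi.single n 1) (Pi.single n 1)) * D := by
    ext i j
    rw [hD, Matrix.mul_diagonal, Matrix.diagonal_mul]
    simp only [massSpringPerturbation, Matrix.sub_apply, Matrix.add_apply, Matrix.smul_apply,
      Matrix.vecMulVec_apply, Matrix.of_apply, Matrix.scalar_apply, Matrix.diagonal_apply,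
      Function.update_apply, Pi.single_apply, Pi.one_apply, smul_eq_mul]
    by_cases hi : i = n
    · by_cases hj : j = n
      · subst hi; subst hj
        simp only [and_self, if_true, hc]
        field_simp
        ring
      · subst hi
        simp [hj, Ne.symm hj]
    · by_cases hj : j = n
      · subst hj
        simp [hi]
        ring
      · simp [hi, hj]
  have hdet : D.det = θ := by
    rw [hD, Matrix.det_diagonal, Finset.prod_update_of_mem (Finset.mem_univ n)]
    simp
  have hV : V.det * V.transpose.det = 1 := by rw [← Matrix.det_mul, h2, Matrix.det_one]
  rw [hfull, ← hmid, Matrix.det_mul, Matrix.det_mul, Matrix.det_mul, Matrix.det_mul, hdet,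
    det_diagonal_add_smul_vecMulVec hxl]
  simp only [hw]
  have hcθ : c * θ ^ 2 = (1 - θ ^ 2) * (x - K) := by rw [hc]; field_simp
  generalize ∑ j, V n j ^ 2 / (x - l j) = S
  generalize ∏ j, (x - l j) = P
  linear_combination θ ^ 2 * P * (1 + c * S) * hV + P * S * hcθ

/-- A solution on the part of the chain to the right of the site `n` that solves the equation at `n`
too, with the value zero at `n`, vanishes. -/
theorem IsJacobi.eq_zero_of_right {N : ℕ} {J : Matrix (Fin N) (Fin N) ℝ} (hJ : IsJacobi J)
    {n : Fin N} {x : ℝ} {r : Fin N → ℝ} (h0 : ∀ k ≤ n, r k = 0)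
    (h : ∀ i, n ≤ i → J.mulVec r i = x * r i) : r = 0 := by
  have key : ∀ (k : ℕ) (hk : k < N), r ⟨k, hk⟩ = 0 := by
    intro k
    induction k using Nat.strong_induction_on with
    | _ k ih =>
      intro hk
      by_cases hkn : k ≤ (n : ℕ)
      · exact h0 _ hkn
      · obtain ⟨i, rfl⟩ : ∃ i, k = i + 1 := ⟨k - 1, by omega⟩
        have hi : i < N := by omega
        have := h ⟨i, hi⟩ (Fin.le_def.2 (by simp only; omega))
        rw [ih i (by omega) hi, mul_zero, Matrix.mulVec, dotProduct,
          Finset.sum_eq_single (⟨i + 1, hk⟩ : Fin N)] at this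
        · exact (mul_eq_zero.1 this).resolve_left (hJ.offDiag_neg ⟨i, hi⟩ ⟨i + 1, hk⟩ rfl).ne
        · intro m _ hm
          have hm' : (m : ℕ) ≠ i + 1 := fun h => hm (Fin.ext h)
          rcases lt_or_ge (m : ℕ) (i + 1) with hlt | hge
          · rw [show r m = 0 from ih m hlt m.2, mul_zero]
          · rw [hJ.tridiagonal ⟨i, hi⟩ m (by simp only; omega), zero_mul]
        · simp
  ext k
  exact key k k.2

/-- The mirror image of `IsJacobi.eq_zero_of_right`. -/
theorem IsJacobi.eq_zero_of_left {N : ℕ} {J : Matrix (Fin N) (Fin N) ℝ} (hJ : IsJacobi J)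
    {n : Fin N} {x : ℝ} {u : Fin N → ℝ} (h0 : ∀ k, n ≤ k → u k = 0)
    (h : ∀ i ≤ n, J.mulVec u i = x * u i) : u = 0 := by
  have key : ∀ (k : ℕ) (m : Fin N), N - 1 - (m : ℕ) = k → u m = 0 := by
    intro k
    induction k using Nat.strong_induction_on with
    | _ k ih =>
      intro m hm
      by_cases hmn : (n : ℕ) ≤ m
      · exact h0 _ hmn
      · have hm1 : (m : ℕ) + 1 < N := by have := n.2; omega
        have hJm : J ⟨m + 1, hm1⟩ m ≠ 0 := by
          rw [← hJ.symm.apply]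
          exact (hJ.offDiag_neg m ⟨m + 1, hm1⟩ rfl).ne
        have := h ⟨m + 1, hm1⟩ (Fin.le_def.2 (by simp only; omega))
        rw [ih (N - 1 - (m + 1)) (by omega) ⟨m + 1, hm1⟩ rfl, mul_zero, Matrix.mulVec, dotProduct,
          Finset.sum_eq_single m] at this
        · exact (mul_eq_zero.1 this).resolve_left hJm
        · intro i _ hi
          have hi' : (i : ℕ) ≠ m := fun h => hi (Fin.ext h)
          have hiN := i.2
          rcases lt_or_ge (m : ℕ) i with hlt | hge
          · rw [ih (N - 1 - i) (by omega) i rfl, mul_zero]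
          · rw [← hJ.symm.apply, hJ.tridiagonal i ⟨m + 1, hm1⟩ (by simp only; omega), zero_mul]
        · simp
  ext k
  exact key _ k rfl

/-- The part of an eigenvector to the left of a site at which it vanishes. -/
theorem IsJacobi.exists_left_part {N : ℕ} {J : Matrix (Fin N) (Fin N) ℝ} (hJ : IsJacobi J)
    {n : Fin N} {x : ℝ} {v : Fin N → ℝ} (hv : J.mulVec v = x • v) (hv0 : v ≠ 0) (hn : v n = 0) :
    ∃ (u : Fin N → ℝ) (c : ℝ), c ≠ 0 ∧ (∀ k, n ≤ k → u k = 0) ∧ (∀ k ≤ n, v k - u k = 0) ∧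
      J.mulVec u = x • u + c • Pi.single n 1 := by
  set u : Fin N → ℝ := fun k => if k < n then v k else 0 with hu
  have hu1 : ∀ k, n ≤ k → u k = 0 := fun k hk => if_neg hk.not_gt
  have hu2 : ∀ k ≤ n, v k - u k = 0 := fun k hk => by
    rcases hk.lt_or_eq with h | rfl
    · rw [hu]; simp only; rw [if_pos h, sub_self]
    · rw [hu1 k le_rfl, hn, sub_zero]
  have hJu : J.mulVec u = x • u + (J.mulVec u n) • Pi.single n 1 := by
    ext i
    rw [Pi.add_apply, Pi.smul_apply, Pi.smul_apply, Pi.single_apply, smul_eq_mul, smul_eq_mul]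
    rcases lt_trichotomy i n with hi | rfl | hi
    · rw [if_neg hi.ne, mul_zero, add_zero]
      have h1 := congrFun hv i
      rw [Pi.smul_apply, smul_eq_mul] at h1
      rw [show u i = v i from (sub_eq_zero.1 (hu2 i hi.le)).symm, ← h1, Matrix.mulVec, Matrix.mulVec]
      refine Finset.sum_congr rfl fun k _ => ?_
      beta_reduce
      rcases le_or_gt k n with hk | hk
      · rw [sub_eq_zero.1 (hu2 k hk)]
      · rw [hJ.tridiagonal i k (by simp only [Fin.lt_def] at hi hk; omega), zero_mul, zero_mul]
    · rw [if_pos rfl, hu1 i le_rfl]; ring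
    · rw [if_neg hi.ne', hu1 i hi.le, mul_zero, mul_zero, add_zero, Matrix.mulVec]
      refine Finset.sum_eq_zero fun k _ => ?_
      beta_reduce
      rcases lt_or_ge k n with hk | hk
      · rw [← hJ.symm.apply, hJ.tridiagonal k i (by simp only [Fin.lt_def] at hi hk; omega),
          zero_mul]
      · rw [hu1 k hk, mul_zero]
  refine ⟨u, J.mulVec u n, fun hc => hv0 ?_, hu1, hu2, hJu⟩
  rw [hc, zero_smul, add_zero] at hJu
  have hu0 : u = 0 := hJ.eq_zero_of_left hu1 fun i _ => by
    rw [hJu, Pi.smul_apply, smul_eq_mul]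
  refine hJ.eq_zero_of_right (n := n) (x := x) (fun k hk => ?_) fun i _ => ?_
  · have := hu2 k hk
    rwa [hu0, Pi.zero_apply, sub_zero] at this
  · rw [hv, Pi.smul_apply, smul_eq_mul]

/-- Eigenvectors with different eigenvalues of the part of the matrix `J` that belongs to a set of
sites are at most as many as the sites in this set. -/
theorem card_le_of_block_eigenvectors {N : ℕ} (J : Matrix (Fin N) (Fin N) ℝ) (p : Finset (Fin N))
    {ι : Type*} [Fintype ι] {μ : ι → ℝ} (hμ : Function.Injective μ) (u : ι → Fin N → ℝ)
    (hu0 : ∀ j, u j ≠ 0) (hup : ∀ j, ∀ k, k ∉ p → u j k = 0)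
    (hJ : ∀ j, ∀ k ∈ p, J.mulVec (u j) k = μ j * u j k) : Fintype.card ι ≤ p.card := by
  set B : Matrix p p ℝ := J.submatrix Subtype.val Subtype.val with hB
  have hlin : LinearIndependent ℝ fun j => fun k : p => u j k := by
    refine Module.End.eigenvectors_linearIndependent' (Matrix.toLin' B) μ hμ _ fun j => ?_
    rw [Module.End.hasEigenvector_iff, Module.End.mem_eigenspace_iff]
    refine ⟨?_, fun h => hu0 j ?_⟩
    · ext k
      rw [Matrix.toLin'_apply, Pi.smul_apply, smul_eq_mul, ← hJ j k k.2, Matrix.mulVec,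
        Matrix.mulVec, dotProduct, dotProduct]
      rw [← Finset.sum_subset (Finset.subset_univ p) fun i _ hi => by rw [hup j i hi, mul_zero]]
      exact Finset.sum_coe_sort p fun i => J k i * u j i
    · ext k
      by_cases hk : k ∈ p
      · exact congrFun h ⟨k, hk⟩
      · exact hup j k hk
  have := hlin.fintype_card_le_finrank
  rwa [Module.finrank_fintype_fun_eq_card, Fintype.card_coe] at this

/-- The squares of the entries at the site `n` of the eigenvectors of a Jacobi matrix satisfy the
conditions of a site weight. -/
theorem exists_isSiteWeight {N : ℕ} {n : Fin N} {l lhat : Fin N → ℝ} {K θ : ℝ}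
    (hl : StrictMono l) (hlhat : StrictMono lhat) (hθ : 0 < θ) {J : Matrix (Fin N) (Fin N) ℝ}
    (hJ : IsJacobi J) (hs : spectrum ℝ J = Set.range l)
    (hst : spectrum ℝ (massSpringPerturbation J n θ (((θ ^ 2)⁻¹ - 1) * K)) = Set.range lhat) :
    ∃ w, IsSiteWeight n l lhat K θ w := by
  obtain ⟨V, h1, h2, h3⟩ := exists_orthogonal_diagonalization hJ.symm hl.injective hs
  set w : ℝ → ℝ := Function.extend l (fun j => V n j ^ 2) 0 with hwdef
  have hw : ∀ j, w (l j) = V n j ^ 2 := fun j => hl.injective.extend_apply _ _ j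
  have hcol : ∀ j, J.mulVec (fun i => V i j) = l j • fun i => V i j := fun j => by
    ext i
    have := congrFun (congrFun h3 i) j
    rw [Matrix.mul_diagonal, Matrix.mul_apply] at this
    rw [Pi.smul_apply, smul_eq_mul, mul_comm, ← this]
    rfl
  have hcol0 : ∀ j, (fun i => V i j) ≠ 0 := fun j h => by
    have := congrFun (congrFun h1 j) j
    rw [Matrix.mul_apply, Matrix.one_apply_eq] at this
    have h0 : ∀ i, V i j = 0 := fun i => congrFun h i
    simp [h0] at this
  have hpart := fun j (hj : V n j = 0) => hJ.exists_left_part (hcol j) (hcol0 j) hj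
  have hZcard : ((pointSet l).filter fun y => w y = 0).card =
      Fintype.card {j // V n j = 0} := by
    rw [Fintype.card_subtype, ← Finset.card_image_of_injective _ hl.injective]
    congr 1
    ext y
    simp only [Finset.mem_filter, mem_pointSet, Finset.mem_image, Finset.mem_univ, true_and]
    constructor
    · rintro ⟨⟨j, rfl⟩, h⟩
      exact ⟨j, by rwa [hw, sq_eq_zero_iff] at h, rfl⟩
    · rintro ⟨j, h, rfl⟩
      exact ⟨⟨j, rfl⟩, by rw [hw, h]; simp⟩
  refine ⟨w, ?_, ?_, ?_, ?_, ?_⟩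
  · intro y hy
    obtain ⟨j, rfl⟩ := mem_pointSet.1 hy
    rw [hw]; positivity
  · rw [sum_pointSet hl.injective]
    have := congrFun (congrFun h2 n) n
    rw [Matrix.mul_apply, Matrix.one_apply_eq] at this
    rw [← this]
    exact Finset.sum_congr rfl fun j _ => by rw [hw, Matrix.transpose_apply, sq]
  · exact perturbationIdentity hl.injective hlhat.injective hθ h2 h3 hst hw
  · rw [hZcard]
    choose! u c hc hu1 hu2 hJu using hpart
    have hinj : Function.Injective fun j : {j // V n j = 0} => l j :=
      hl.injective.comp Subtype.val_injective
    refine le_min ?_ ?_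
    · have := card_le_of_block_eigenvectors J (Finset.Iio n) hinj (fun j => u j)
        (fun j h => ?_) (fun j k hk => hu1 j j.2 k (by simpa using hk)) fun j k hk => ?_
      · simpa using this
      · have := congrFun (hJu j j.2) n
        rw [h] at this
        simp at this
        exact hc j j.2 this.symm
      · rw [hJu j j.2]
        simp [(Finset.mem_Iio.1 hk).ne]
    · have hr : ∀ j, V n j = 0 → J.mulVec ((fun i => V i j) - u j) =
          l j • ((fun i => V i j) - u j) - c j • Pi.single n 1 := fun j hj => by
        rw [Matrix.mulVec_sub, hcol, hJu j hj, smul_sub]; abel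
      have := card_le_of_block_eigenvectors J (Finset.Ioi n) hinj
        (fun j => (fun i => V i j) - u j)
        (fun j h => ?_) (fun j k hk => hu2 j j.2 k (by simpa using hk)) fun j k hk => ?_
      · rw [Fin.card_Ioi] at this
        omega
      · have := congrFun (hr j j.2) n
        rw [h] at this
        simp at this
        exact hc j j.2 this
      · rw [hr j j.2]
        simp [(Finset.mem_Ioi.1 hk).ne']
  · intro y hy hy0
    obtain ⟨j, rfl⟩ := mem_pointSet.1 hy
    rw [hw, sq_eq_zero_iff] at hy0
    obtain ⟨u, c, hc, hu1, -, hJu⟩ := hpart j hy0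
    set q := V.transpose.mulVec u with hq
    -- The coordinates of `(J - l j) u = c e_n` in the eigenbasis.
    have hcoord : ∀ i, (l i - l j) * q i = c * V n i := fun i => by
      have e1 : V.transpose.mulVec (J.mulVec u) = (Matrix.diagonal l).mulVec q := by
        have := congrArg Matrix.transpose h3
        rw [Matrix.transpose_mul, Matrix.transpose_mul, Matrix.diagonal_transpose, hJ.symm.eq] at this
        rw [Matrix.mulVec_mulVec, this, hq, Matrix.mulVec_mulVec]
      rw [hJu, Matrix.mulVec_add, Matrix.mulVec_smul, Matrix.mulVec_smul, ← hq] at e1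
      have := congrFun e1 i
      simp [Matrix.mulVec_diagonal] at this
      linarith
    have hsum : ∑ i, V n i * q i = 0 := by
      have : V.mulVec q = u := by rw [hq, Matrix.mulVec_mulVec, h2, Matrix.one_mulVec]
      have h := congrFun this n
      rw [hu1 n le_rfl] at h
      exact h
    have hterm : ∀ z ∈ (pointSet l).erase (l j), ∀ i, l i = z →
        w z / (l j - z) = -c⁻¹ * (V n i * q i) := by
      rintro z hz i rfl
      have hne : l i - l j ≠ 0 := sub_ne_zero.2 (Finset.ne_of_mem_erase hz)
      have hqi : q i = c * V n i / (l i - l j) := by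
        rw [eq_div_iff hne, ← hcoord i, mul_comm]
      have hne' : l j - l i ≠ 0 := by rw [← neg_sub]; exact neg_ne_zero.2 hne
      rw [hw, hqi]
      field_simp
      ring
    have herase : (pointSet l).erase (l j) = (Finset.univ.erase j).image l := by
      rw [Finset.image_erase hl.injective, pointSet]
    rw [herase, Finset.sum_image fun _ _ _ _ h => hl.injective h]
    rw [Finset.sum_congr rfl fun i hi => hterm (l i)
      (by rw [herase]; exact Finset.mem_image_of_mem l hi) i rfl, ← Finset.mul_sum,
      Finset.sum_erase _ (by rw [hy0, zero_mul]), hsum, mul_zero]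

/-! ### Interlacing and the quotient of the characteristic polynomials -/

/-- The place of an eigenvalue of the perturbed matrix: it has moved from `l i` towards `K`, but not
past `K` and not as far as the next eigenvalue on its way. -/
def Slot {N : ℕ} (l : Fin N → ℝ) (K : ℝ) (i : Fin N) (x : ℝ) : Prop :=
  (l i < K → l i ≤ x ∧ x < K ∧ ∀ j, i < j → x < l j) ∧ (l i = K → x = K) ∧
    (K < l i → x ≤ l i ∧ K < x ∧ ∀ j, j < i → l j < x)

theorem Slot.lt {N : ℕ} {l : Fin N → ℝ} {K : ℝ} (hl : StrictMono l) {i j : Fin N} (hij : i < j)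
    {x y : ℝ} (hx : Slot l K i x) (hy : Slot l K j y) : x < y := by
  have hlij := hl hij
  rcases lt_trichotomy (l i) K with hi | hi | hi
  · obtain ⟨h1, h2, h3⟩ := hx.1 hi
    rcases lt_trichotomy (l j) K with hj | hj | hj
    · exact (h3 j hij).trans_le (hy.1 hj).1
    · rwa [hy.2.1 hj]
    · exact h2.trans (hy.2.2 hj).2.1
  · rw [hx.2.1 hi]
    exact (hy.2.2 (hi ▸ hlij)).2.1
  · exact (hx.2.2 hi).1.trans_lt ((hy.2.2 (hi.trans hlij)).2.2 i hij)

/-- The slots are ordered as the indices, so if each of them contains a point of `lhat`, then the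
`i`-th of them contains the `i`-th point. -/
theorem slot_of_exists {N : ℕ} {l lhat : Fin N → ℝ} {K : ℝ} (hl : StrictMono l)
    (hlhat : StrictMono lhat) (h : ∀ i, ∃ k, Slot l K i (lhat k)) (i : Fin N) :
    Slot l K i (lhat i) := by
  choose f hf using h
  have hmono : StrictMono f := fun i j hij =>
    hlhat.lt_iff_lt.1 (Slot.lt hl hij (hf i) (hf j))
  have hid : f = id := (hmono.range_inj strictMono_id).1 (by
    rw [(Finite.surjective_of_injective hmono.injective).range_eq, Set.range_id])
  have := hf i
  rwa [hid] at this

theorem exists_card_lt {N : ℕ} {l : Fin N → ℝ} (hl : StrictMono l) (K : ℝ) :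
    ∃ p ≤ N, (∀ i : Fin N, (i : ℕ) < p → l i < K) ∧ ∀ i : Fin N, p ≤ (i : ℕ) → K ≤ l i := by
  by_cases h : ∃ k, ∃ hk : k < N, K ≤ l ⟨k, hk⟩
  · classical
    obtain ⟨hlt, hK⟩ := Nat.find_spec h
    refine ⟨Nat.find h, hlt.le, fun i hi => ?_, fun i hi => hK.trans (hl.monotone hi)⟩
    exact not_le.1 fun hc => Nat.find_min h hi ⟨i.2, hc⟩
  · push Not at h
    exact ⟨N, le_rfl, fun i _ => h i i.2, fun i hi => absurd i.2 (by omega)⟩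

theorem interlace_of_slot {N : ℕ} {l lhat : Fin N → ℝ} {K : ℝ} (hl : StrictMono l)
    (h : ∀ i, Slot l K i (lhat i)) : Interlace l lhat K := by
  have uniqL : ∀ i k, l i < K → l i ≤ lhat k → lhat k < K → (∀ j, i < j → lhat k < l j) →
      k = i := by
    intro i k hi h1 h2 h3
    rcases lt_trichotomy k i with hk | hk | hk
    · exact absurd (((h k).1 ((hl hk).trans hi)).2.2 i hk) h1.not_gt
    · exact hk
    · rcases lt_trichotomy (l k) K with hK | hK | hK
      · exact absurd (h3 k hk) ((h k).1 hK).1.not_gt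
      · exact absurd h2 ((h k).2.1 hK).ge.not_gt
      · exact absurd h2 ((h k).2.2 hK).2.1.le.not_gt
  have uniqR : ∀ i k, K < l i → lhat k ≤ l i → K < lhat k → (∀ j, j < i → l j < lhat k) →
      k = i := by
    intro i k hi h1 h2 h3
    rcases lt_trichotomy k i with hk | hk | hk
    · rcases lt_trichotomy (l k) K with hK | hK | hK
      · exact absurd h2 ((h k).1 hK).2.1.le.not_gt
      · exact absurd h2 ((h k).2.1 hK).le.not_gt
      · exact absurd (h3 k hk) ((h k).2.2 hK).1.not_gt
    · exact hk
    · exact absurd (((h k).2.2 (hi.trans (hl hk))).2.2 i hk) h1.not_gt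
  obtain ⟨p, hp, h1, h2⟩ := exists_card_lt hl K
  refine ⟨p, hp, h1, h2, fun i j hij hj => ?_, fun i j hij hi => ?_, fun i hi => ?_,
    fun i hi hK => ?_⟩
  · have hi := h1 i (by omega)
    have hs := (h i).1 hi
    refine ⟨i, ⟨hs.1, hs.2.2 j (Fin.lt_def.2 (by omega))⟩, fun k hk => ?_⟩
    refine uniqL i k hi hk.1 (hk.2.trans (h1 j hj)) fun m hm => hk.2.trans_le (hl.monotone ?_)
    simp only [Fin.lt_def, Fin.le_def] at hm ⊢; omega
  · have hlij : l i < l j := hl (Fin.lt_def.2 (by omega))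
    have hj := (h2 i hi).trans_lt hlij
    have hs := (h j).2.2 hj
    refine ⟨j, ⟨hs.2.2 i (Fin.lt_def.2 (by omega)), hs.1⟩, fun k hk => ?_⟩
    refine uniqR j k hj hk.2 ((h2 i hi).trans_lt hk.1) fun m hm =>
      (hl.monotone ?_).trans_lt hk.1
    simp only [Fin.lt_def, Fin.le_def] at hm ⊢; omega
  · have hi' := h1 i (by omega)
    have hs := (h i).1 hi'
    refine ⟨i, ⟨hs.1, hs.2.1⟩, fun k hk => uniqL i k hi' hk.1 hk.2 fun m hm =>
      hk.2.trans_le (h2 m ?_)⟩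
    simp only [Fin.lt_def] at hm; omega
  · have hs := (h i).2.2 hK
    refine ⟨i, ⟨hs.2.1, hs.1⟩, fun k hk => uniqR i k hK hk.2 hk.1 fun m hm =>
      (h1 m ?_).trans hk.1⟩
    simp only [Fin.lt_def] at hm; omega

theorem slot_of_interlace {N : ℕ} {l lhat : Fin N → ℝ} {K : ℝ} (hl : StrictMono l)
    (hlhat : StrictMono lhat) (h : Interlace l lhat K)
    (hK : K ∈ pointSet l → K ∈ pointSet lhat) (i : Fin N) : Slot l K i (lhat i) := by
  obtain ⟨p, hp, h1, h2, hA, hB, hC, hD⟩ := h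
  refine slot_of_exists hl hlhat (fun i => ?_) i
  rcases lt_trichotomy (l i) K with hi | hi | hi
  · suffices ∃ k, l i ≤ lhat k ∧ lhat k < K ∧ ∀ j, i < j → lhat k < l j by
      obtain ⟨k, hk⟩ := this
      exact ⟨k, fun _ => hk, fun h => absurd h hi.ne, fun h => absurd h hi.not_gt⟩
    have hip : (i : ℕ) < p := by
      by_contra hc
      exact (h2 i (by omega)).not_gt hi
    by_cases hip1 : (i : ℕ) + 1 = p
    · obtain ⟨k, hk, -⟩ := hC i hip1
      refine ⟨k, hk.1, hk.2, fun j hj => hk.2.trans_le (h2 j ?_)⟩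
      simp only [Fin.lt_def] at hj; omega
    · have hiN : (i : ℕ) + 1 < N := by
        by_contra hc
        have := i.2
        omega
      obtain ⟨k, hk, -⟩ := hA i ⟨i + 1, hiN⟩ rfl (by simp only; omega)
      refine ⟨k, hk.1, hk.2.trans (h1 _ (by simp only; omega)), fun j hj =>
        hk.2.trans_le (hl.monotone ?_)⟩
      simp only [Fin.lt_def, Fin.le_def] at hj ⊢; omega
  · obtain ⟨k, hk⟩ := mem_pointSet.1 (hK (mem_pointSet.2 ⟨i, hi⟩))
    exact ⟨k, fun h => absurd hi h.ne, fun _ => hk, fun h => absurd hi h.ne'⟩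
  · suffices ∃ k, lhat k ≤ l i ∧ K < lhat k ∧ ∀ j, j < i → l j < lhat k by
      obtain ⟨k, hk⟩ := this
      exact ⟨k, fun h => absurd h hi.not_gt, fun h => absurd h hi.ne', fun _ => hk⟩
    have hip : p ≤ (i : ℕ) := by
      by_contra hc
      exact (h1 i (by omega)).not_gt hi
    by_cases hip1 : (i : ℕ) = p
    · obtain ⟨k, hk, -⟩ := hD i hip1 hi
      refine ⟨k, hk.2, hk.1, fun j hj => (h1 j ?_).trans hk.1⟩
      simp only [Fin.lt_def] at hj; omega
    · have hiN := i.2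
      obtain ⟨k, hk, -⟩ := hB ⟨i - 1, by omega⟩ i (by simp only; omega) (by simp only; omega)
      refine ⟨k, hk.2, (h2 _ (by simp only; omega)).trans_lt hk.1, fun j hj =>
        (hl.monotone ?_).trans_lt hk.1⟩
      simp only [Fin.lt_def, Fin.le_def] at hj ⊢; omega

/-- The rational function `θ² + (1 - θ²) (x - K) ∑ w y / (x - y)`, which is the quotient of the
characteristic polynomials of the perturbed and the unperturbed matrix. -/
noncomputable def quotientFun (σ : Finset ℝ) (w : ℝ → ℝ) (K θ x : ℝ) : ℝ :=
  θ ^ 2 + (1 - θ ^ 2) * (x - K) * ∑ y ∈ σ, w y / (x - y)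

section Perturbed

variable {N : ℕ} {l lhat : Fin N → ℝ} {K θ : ℝ} {w : ℝ → ℝ}

theorem eval_rootPoly_hat (hp : PerturbationIdentity l lhat K θ w) {x : ℝ} (hx : x ∉ pointSet l) :
    (rootPoly (pointSet lhat)).eval x =
      (rootPoly (pointSet l)).eval x * quotientFun (pointSet l) w K θ x := by
  rw [hp, quotientFun]
  simp only [eval_add, eval_mul, eval_C, eval_sub, eval_X]
  rw [eval_residuePoly_of_notMem _ hx]
  ring

theorem eval_rootPoly_hat_of_mem (hp : PerturbationIdentity l lhat K θ w) {y : ℝ} (hy : y ∈ pointSet l) :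
    (rootPoly (pointSet lhat)).eval y =
      (1 - θ ^ 2) * (y - K) * w y * (rootPoly ((pointSet l).erase y)).eval y := by
  rw [hp]
  simp only [eval_add, eval_mul, eval_C, eval_sub, eval_X]
  rw [eval_residuePoly_of_mem _ hy, eval_rootPoly_eq_zero_iff.2 hy]
  ring

theorem Nhat_eq_quotientFun (hl : StrictMono l) (hlhat : StrictMono lhat)
    (hp : PerturbationIdentity l lhat K θ w) {x : ℝ} (hx : x ∉ pointSet l) :
    Nhat l lhat x = quotientFun (pointSet l) w K θ x := by
  have hP : (rootPoly (pointSet l)).eval x ≠ 0 := fun h => hx (eval_rootPoly_eq_zero_iff.1 h)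
  have e : ∀ f : Fin N → ℝ, StrictMono f → ∏ j, (x - f j) = (rootPoly (pointSet f)).eval x :=
    fun f hf => by
      rw [eval_rootPoly]
      exact (Finset.prod_image fun _ _ _ _ h => hf.injective h).symm
  rw [Nhat_eq_div hl hlhat fun j h => hx (mem_pointSet.2 ⟨j, h.symm⟩), e l hl, e lhat hlhat,
    eval_rootPoly_hat hp hx, mul_div_cancel_left₀ _ hP]

theorem Nhat_of_notMem (hl : StrictMono l) (hlhat : StrictMono lhat)
    (hp : PerturbationIdentity l lhat K θ w) (hK : K ∉ pointSet l) :
    Nhat l lhat K = θ ^ 2 := by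
  rw [Nhat_eq_quotientFun hl hlhat hp hK, quotientFun]; ring

theorem mem_pointSet_hat_iff (hθ : 0 < θ) (hθ1 : θ < 1)
    (hp : PerturbationIdentity l lhat K θ w) {y : ℝ} (hy : y ∈ pointSet l) :
    y ∈ pointSet lhat ↔ y = K ∨ w y = 0 := by
  have h1 : 1 - θ ^ 2 ≠ 0 := by nlinarith
  have h2 : (rootPoly ((pointSet l).erase y)).eval y ≠ 0 := fun h =>
    Finset.notMem_erase y _ (eval_rootPoly_eq_zero_iff.1 h)
  rw [← eval_rootPoly_eq_zero_iff, eval_rootPoly_hat_of_mem hp hy]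
  simp [h1, h2, sub_eq_zero]

theorem continuousAt_sum_erase (σ : Finset ℝ) (w : ℝ → ℝ) (y : ℝ) :
    ContinuousAt (fun x => ∑ z ∈ σ.erase y, w z / (x - z)) y :=
  tendsto_finsetSum _ fun _ hz => ContinuousAt.div continuousAt_const
    (continuousAt_id.sub continuousAt_const) (sub_ne_zero.2 (Finset.ne_of_mem_erase hz).symm)

theorem eventually_notMem_erase (σ : Finset ℝ) (y : ℝ) : ∀ᶠ x in 𝓝 y, x ∉ σ.erase y :=
  (σ.erase y).finite_toSet.isClosed.isOpen_compl.mem_nhds (by simp)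

theorem eventually_notMem (σ : Finset ℝ) (y : ℝ) : ∀ᶠ x in 𝓝[≠] y, x ∉ σ := by
  filter_upwards [(eventually_notMem_erase σ y).filter_mono nhdsWithin_le_nhds,
    self_mem_nhdsWithin] with x hx hxy h
  exact hx (Finset.mem_erase.2 ⟨hxy, h⟩)

theorem quotientFun_eq {σ : Finset ℝ} {y x : ℝ} (hy : y ∈ σ) :
    quotientFun σ w K θ x = θ ^ 2 + (1 - θ ^ 2) * (x - K) *
      (w y / (x - y) + ∑ z ∈ σ.erase y, w z / (x - z)) := by
  rw [quotientFun, Finset.add_sum_erase σ (fun z => w z / (x - z)) hy]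

/-- At a common point the reduced fraction `Nhat` is the continuous extension of the quotient of the
characteristic polynomials. -/
theorem Nhat_eventuallyEq (hl : StrictMono l) (hlhat : StrictMono lhat)
    (hp : PerturbationIdentity l lhat K θ w) {y : ℝ} (hy : y ∈ pointSet lhat)
    {H : ℝ → ℝ} (hH : ContinuousAt H y)
    (h : ∀ x, x ∉ pointSet l → x ≠ y → quotientFun (pointSet l) w K θ x = H x) :
    Nhat l lhat =ᶠ[𝓝 y] H := by
  have hc : ContinuousAt (Nhat l lhat) y := by
    refine ContinuousAt.div ?_ ?_ ?_
    · exact (continuous_finsetProd _ fun z _ => continuous_id.sub continuous_const).continuousAt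
    · exact (continuous_finsetProd _ fun z _ => continuous_id.sub continuous_const).continuousAt
    · refine Finset.prod_ne_zero_iff.2 fun z hz => sub_ne_zero.2 fun h => ?_
      exact (Finset.mem_sdiff.1 hz).2 (h ▸ hy)
  refine (hc.eventuallyEq_nhds_iff_eventuallyEq_nhdsNE hH).1 ?_
  filter_upwards [eventually_notMem (pointSet l) y, self_mem_nhdsWithin] with x hx hxy
  rw [Nhat_eq_quotientFun hl hlhat hp hx, h x hx hxy]

theorem Nhat_common (hl : StrictMono l) (hlhat : StrictMono lhat)
    (hp : PerturbationIdentity l lhat K θ w) {y : ℝ} (hy : y ∈ pointSet l)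
    (hyhat : y ∈ pointSet lhat) (hw : w y = 0) :
    Nhat l lhat y =
      θ ^ 2 + (1 - θ ^ 2) * (y - K) * ∑ z ∈ (pointSet l).erase y, w z / (y - z) := by
  have hc := continuousAt_sum_erase (pointSet l) w y
  refine (Nhat_eventuallyEq (H := fun x => θ ^ 2 + (1 - θ ^ 2) * (x - K) *
    ∑ z ∈ (pointSet l).erase y, w z / (x - z)) hl hlhat hp hyhat (by fun_prop)
    fun x _ _ => ?_).eq_of_nhds
  rw [quotientFun_eq hy, hw, zero_div, zero_add]

theorem Nhat_eventuallyEq_at_K (hl : StrictMono l) (hlhat : StrictMono lhat)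
    (hp : PerturbationIdentity l lhat K θ w) (hK : K ∈ pointSet l)
    (hKhat : K ∈ pointSet lhat) :
    Nhat l lhat =ᶠ[𝓝 K] fun x => θ ^ 2 + (1 - θ ^ 2) *
      (w K + (x - K) * ∑ z ∈ (pointSet l).erase K, w z / (x - z)) := by
  have hc := continuousAt_sum_erase (pointSet l) w K
  refine Nhat_eventuallyEq hl hlhat hp hKhat (by fun_prop) fun x _ hx => ?_
  rw [quotientFun_eq hK]
  have := sub_ne_zero.2 hx
  field_simp

theorem Nhat_at_K (hl : StrictMono l) (hlhat : StrictMono lhat)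
    (hp : PerturbationIdentity l lhat K θ w) (hK : K ∈ pointSet l)
    (hKhat : K ∈ pointSet lhat) : Nhat l lhat K = θ ^ 2 + (1 - θ ^ 2) * w K := by
  rw [(Nhat_eventuallyEq_at_K hl hlhat hp hK hKhat).eq_of_nhds]; ring

theorem deriv_Nhat_at_K (hl : StrictMono l) (hlhat : StrictMono lhat)
    (hp : PerturbationIdentity l lhat K θ w) (hK : K ∈ pointSet l)
    (hKhat : K ∈ pointSet lhat) : deriv (Nhat l lhat) K =
      (1 - θ ^ 2) * ∑ z ∈ (pointSet l).erase K, w z / (K - z) := by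
  have hd : DifferentiableAt ℝ (fun x => ∑ z ∈ (pointSet l).erase K, w z / (x - z)) K :=
    DifferentiableAt.fun_sum fun z hz => (differentiableAt_const _).div (by fun_prop)
      (sub_ne_zero.2 (Finset.ne_of_mem_erase hz).symm)
  rw [(Nhat_eventuallyEq_at_K hl hlhat hp hK hKhat).deriv_eq]
  have h1 := ((hasDerivAt_id K).sub_const K).mul hd.hasDerivAt
  have h2 := ((h1.const_add (w K)).const_mul (1 - θ ^ 2)).const_add (θ ^ 2)
  refine (h2.congr_deriv ?_).deriv
  simp

end Perturbed

/-- Near a pole `b` the quotient is negative on the side towards `K` and positive on the other. -/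
theorem eventually_quotientFun_sign {σ : Finset ℝ} {w : ℝ → ℝ} {K θ b : ℝ} (hθ : 0 < θ) (hθ1 : θ < 1)
    (hb : b ∈ σ) (hbK : b ≠ K) (hw : 0 < w b) :
    ∀ᶠ x in 𝓝[≠] b, 0 < (b - K) * ((x - b) * quotientFun σ w K θ x) := by
  have hc := continuousAt_sum_erase σ w b
  have h1 : 0 < 1 - θ ^ 2 := by nlinarith
  have hbK' := sub_ne_zero.2 hbK
  have hcont : ContinuousAt (fun x => (b - K) * ((x - b) * θ ^ 2 + (1 - θ ^ 2) * (x - K) *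
      (w b + (x - b) * ∑ z ∈ σ.erase b, w z / (x - z)))) b := by fun_prop
  have hpos : 0 < (b - K) * ((b - b) * θ ^ 2 + (1 - θ ^ 2) * (b - K) *
      (w b + (b - b) * ∑ z ∈ σ.erase b, w z / (b - z))) := by
    have : 0 < (b - K) ^ 2 * ((1 - θ ^ 2) * w b) := by positivity
    calc 0 < _ := this
      _ = _ := by ring
  filter_upwards [(hcont.eventually (lt_mem_nhds hpos)).filter_mono nhdsWithin_le_nhds,
    self_mem_nhdsWithin] with x hx hxb
  have hxb' : x - b ≠ 0 := sub_ne_zero.2 hxb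
  have e : (x - b) * quotientFun σ w K θ x = (x - b) * θ ^ 2 + (1 - θ ^ 2) * (x - K) *
      (w b + (x - b) * ∑ z ∈ σ.erase b, w z / (x - z)) := by
    rw [quotientFun_eq hb]
    field_simp
  rwa [e]

/-- At `K` and at a point of weight zero the continuous extension of the quotient is at least `θ²`. -/
theorem eventually_quotientFun_pos {σ : Finset ℝ} {w : ℝ → ℝ} {K θ a : ℝ} (hθ : 0 < θ) (hθ1 : θ < 1)
    (hw : ∀ y ∈ σ, 0 ≤ w y)
    (hres : ∀ y ∈ σ, w y = 0 → ∑ z ∈ σ.erase y, w z / (y - z) = 0)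
    (ha : a = K ∨ (a ∈ σ ∧ w a = 0)) :
    ∀ᶠ x in 𝓝[≠] a, 0 < quotientFun σ w K θ x := by
  have hc := continuousAt_sum_erase σ w a
  have h1 : 0 < 1 - θ ^ 2 := by nlinarith
  have hθ2 : 0 < θ ^ 2 := by positivity
  suffices ∃ H : ℝ → ℝ, ContinuousAt H a ∧ 0 < H a ∧
      ∀ x, x ≠ a → quotientFun σ w K θ x = H x by
    obtain ⟨H, h2, h3, h4⟩ := this
    filter_upwards [(h2.eventually (lt_mem_nhds h3)).filter_mono nhdsWithin_le_nhds,
      self_mem_nhdsWithin] with x hx hxa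
    rwa [h4 x hxa]
  by_cases haσ : a ∈ σ
  · by_cases hwa : w a = 0
    · refine ⟨fun x => θ ^ 2 + (1 - θ ^ 2) * (x - K) * ∑ z ∈ σ.erase a, w z / (x - z),
        by fun_prop, ?_, fun x _ => ?_⟩
      · simp only; rw [hres a haσ hwa]; simpa using hθ2
      · rw [quotientFun_eq haσ, hwa, zero_div, zero_add]
    · obtain rfl := ha.resolve_right fun h => hwa h.2
      refine ⟨fun x => θ ^ 2 + (1 - θ ^ 2) * (w a + (x - a) * ∑ z ∈ σ.erase a, w z / (x - z)),
        by fun_prop, ?_, fun x hx => ?_⟩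
      · have := mul_nonneg h1.le (hw a haσ)
        simp only [sub_self, zero_mul, add_zero]
        linarith
      · rw [quotientFun_eq haσ]
        have := sub_ne_zero.2 hx
        field_simp
  · obtain rfl := ha.resolve_right fun h => haσ h.1
    rw [Finset.erase_eq_of_notMem haσ] at hc
    refine ⟨quotientFun σ w a θ, ?_, by simpa [quotientFun] using hθ2, fun _ _ => rfl⟩
    unfold quotientFun
    fun_prop

/-- Near `K` or an eigenvalue `a`, the quotient is positive on the side away from `K`. -/
theorem eventually_quotientFun_pos_away {σ : Finset ℝ} {w : ℝ → ℝ} {K θ a : ℝ} (hθ : 0 < θ)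
    (hθ1 : θ < 1) (hw : ∀ y ∈ σ, 0 ≤ w y)
    (hres : ∀ y ∈ σ, w y = 0 → ∑ z ∈ σ.erase y, w z / (y - z) = 0) (ha : a = K ∨ a ∈ σ) :
    ∀ᶠ x in 𝓝[≠] a, 0 ≤ (a - K) * (x - a) → 0 < quotientFun σ w K θ x := by
  by_cases h : a = K ∨ (a ∈ σ ∧ w a = 0)
  · filter_upwards [eventually_quotientFun_pos hθ hθ1 hw hres h] with x hx _ using hx
  · push Not at h
    have haσ := ha.resolve_left h.1
    filter_upwards [eventually_quotientFun_sign hθ hθ1 haσ h.1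
      ((hw a haσ).lt_of_ne' (h.2 haσ))] with x hx hxa
    rw [← mul_assoc] at hx
    exact (pos_iff_pos_of_mul_pos hx).1 (hxa.lt_of_ne' (left_ne_zero_of_mul hx.ne'))

theorem exists_point_of_sign_change {N : ℕ} {l lhat : Fin N → ℝ} {K θ : ℝ} {w : ℝ → ℝ}
    (hp : PerturbationIdentity l lhat K θ w) {c d : ℝ}
    (hσ : ∀ y ∈ pointSet l, y ∉ Set.Ioo c d)
    (hpos : ∃ x ∈ Set.Ioo c d, 0 < quotientFun (pointSet l) w K θ x)
    (hneg : ∃ x ∈ Set.Ioo c d, quotientFun (pointSet l) w K θ x < 0) :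
    ∃ k, lhat k ∈ Set.Ioo c d := by
  obtain ⟨x₁, hx₁, h₁⟩ := hpos
  obtain ⟨x₂, hx₂, h₂⟩ := hneg
  have hcont : ContinuousOn (quotientFun (pointSet l) w K θ) (Set.Ioo c d) := by
    refine continuousOn_const.add ((continuousOn_const.mul
      (continuousOn_id.sub continuousOn_const)).mul (continuousOn_finsetSum _ fun y hy => ?_))
    exact continuousOn_const.div (continuousOn_id.sub continuousOn_const)
      fun x hx => sub_ne_zero.2 fun h => hσ y hy (h ▸ hx)
  obtain ⟨x, hx, hx0⟩ := isPreconnected_Ioo.intermediate_value hx₂ hx₁ hcont ⟨h₂.le, h₁.le⟩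
  have : x ∈ pointSet lhat := by
    rw [← eval_rootPoly_eq_zero_iff, eval_rootPoly_hat hp fun h => hσ x h hx, hx0, mul_zero]
  obtain ⟨k, rfl⟩ := mem_pointSet.1 this
  exact ⟨k, hx⟩

/-- An eigenvalue of positive weight is a pole of the quotient, so the quotient changes sign between
it and the next eigenvalue (or `K`) in the direction of `K`, and an eigenvalue of weight zero stays
where it is. So every slot contains a point of the perturbed spectrum. -/
theorem IsSiteWeight.slot {N : ℕ} {n : Fin N} {l lhat : Fin N → ℝ} {K θ : ℝ} {w : ℝ → ℝ}
    (h : IsSiteWeight n l lhat K θ w) (hl : StrictMono l) (hlhat : StrictMono lhat) (hθ : 0 < θ)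
    (hθ1 : θ < 1) (i : Fin N) : Slot l K i (lhat i) := by
  refine slot_of_exists hl hlhat (fun i => ?_) i
  have hi : l i ∈ pointSet l := mem_pointSet.2 ⟨i, rfl⟩
  have hmem := mem_pointSet_hat_iff hθ hθ1 h.perturbed hi
  by_cases hKw : l i = K ∨ w (l i) = 0
  · obtain ⟨k, hk⟩ := mem_pointSet.1 (hmem.2 hKw)
    refine ⟨k, ?_⟩
    rw [hk]
    exact ⟨fun h => ⟨le_rfl, h, fun j hj => hl hj⟩, id, fun h => ⟨le_rfl, h, fun j hj => hl hj⟩⟩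
  push Not at hKw
  have hwpos : 0 < w (l i) := (h.nonneg _ hi).lt_of_ne' hKw.2
  have hsign := eventually_quotientFun_sign hθ hθ1 hi hKw.1 hwpos
  rcases lt_or_gt_of_ne hKw.1 with hiK | hiK
  · -- The end `a` of the slot is the next eigenvalue, unless this is beyond `K`.
    obtain ⟨a, hia, haK, haj, ha⟩ : ∃ a, l i < a ∧ a ≤ K ∧ (∀ j, i < j → a ≤ l j) ∧
        (a = K ∨ a ∈ pointSet l) := by
      by_cases hc : ∃ hiN : (i : ℕ) + 1 < N, l ⟨i + 1, hiN⟩ ≤ K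
      · obtain ⟨hiN, hc⟩ := hc
        refine ⟨l ⟨i + 1, hiN⟩, hl (Fin.lt_def.2 (Nat.lt_succ_self _)), hc,
          fun j hj => hl.monotone ?_, Or.inr (mem_pointSet.2 ⟨_, rfl⟩)⟩
        simp only [Fin.lt_def, Fin.le_def] at hj ⊢; omega
      · push Not at hc
        refine ⟨K, hiK, le_rfl, fun j hj => ?_, Or.inl rfl⟩
        have hj' : (i : ℕ) < j := hj
        refine (hc (by have := j.2; omega)).le.trans (hl.monotone ?_)
        simp only [Fin.le_def]; omega
    have haway := eventually_quotientFun_pos_away hθ hθ1 h.nonneg h.resolvent_eq_zero ha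
    obtain ⟨k, hk⟩ := exists_point_of_sign_change h.perturbed (c := l i) (d := a)
      (fun y hy hy' => by
        obtain ⟨j, rfl⟩ := mem_pointSet.1 hy
        exact hy'.2.not_ge (haj j (hl.lt_iff_lt.1 hy'.1)))
      (by
        obtain ⟨x, hx1, hx2⟩ := ((haway.filter_mono (nhdsLT_le_nhdsNE a)).and
          (Ioo_mem_nhdsLT hia)).exists
        exact ⟨x, hx2, hx1 (mul_nonneg_of_nonpos_of_nonpos (by linarith) (by linarith [hx2.2]))⟩)
      (by
        obtain ⟨x, hx1, hx2⟩ := ((hsign.filter_mono (nhdsGT_le_nhdsNE _)).and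
          (Ioo_mem_nhdsGT hia)).exists
        have h1 := neg_of_mul_pos_right hx1 (by linarith)
        exact ⟨x, hx2, (pos_iff_neg_of_mul_neg h1).1 (by linarith [hx2.1])⟩)
    exact ⟨k, fun _ => ⟨hk.1.le, hk.2.trans_le haK, fun j hj => hk.2.trans_le (haj j hj)⟩,
      fun h => absurd h hiK.ne, fun h => absurd h hiK.not_gt⟩
  · obtain ⟨a, hia, haK, haj, ha⟩ : ∃ a, a < l i ∧ K ≤ a ∧ (∀ j, j < i → l j ≤ a) ∧
        (a = K ∨ a ∈ pointSet l) := by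
      have hiN := i.2
      by_cases hc : 0 < (i : ℕ) ∧ K ≤ l ⟨i - 1, by omega⟩
      · obtain ⟨h0, hc⟩ := hc
        refine ⟨l ⟨i - 1, by omega⟩, hl (Fin.lt_def.2 (by simp only; omega)), hc,
          fun j hj => hl.monotone ?_, Or.inr (mem_pointSet.2 ⟨_, rfl⟩)⟩
        simp only [Fin.lt_def, Fin.le_def] at hj ⊢; omega
      · push Not at hc
        refine ⟨K, hiK, le_rfl, fun j hj => ?_, Or.inl rfl⟩
        have hj' : (j : ℕ) < i := hj
        refine (hl.monotone ?_).trans (hc (by omega)).le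
        simp only [Fin.le_def]; omega
    have haway := eventually_quotientFun_pos_away hθ hθ1 h.nonneg h.resolvent_eq_zero ha
    obtain ⟨k, hk⟩ := exists_point_of_sign_change h.perturbed (c := a) (d := l i)
      (fun y hy hy' => by
        obtain ⟨j, rfl⟩ := mem_pointSet.1 hy
        exact hy'.1.not_ge (haj j (hl.lt_iff_lt.1 hy'.2)))
      (by
        obtain ⟨x, hx1, hx2⟩ := ((haway.filter_mono (nhdsGT_le_nhdsNE a)).and
          (Ioo_mem_nhdsGT hia)).exists
        exact ⟨x, hx2, hx1 (mul_nonneg (by linarith) (by linarith [hx2.1]))⟩)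
      (by
        obtain ⟨x, hx1, hx2⟩ := ((hsign.filter_mono (nhdsLT_le_nhdsNE _)).and
          (Ioo_mem_nhdsLT hia)).exists
        refine ⟨x, hx2, ?_⟩
        have h1 := pos_of_mul_pos_right hx1 (by linarith)
        by_contra hcon
        push Not at hcon
        have := mul_nonpos_of_nonpos_of_nonneg (show x - l i ≤ 0 by linarith [hx2.2]) hcon
        linarith)
    exact ⟨k, fun h => absurd h hiK.not_gt, fun h => absurd h hiK.ne',
      fun _ => ⟨hk.2.le, haK.trans_lt hk.1, fun j hj => (haj j hj).trans_lt hk.1⟩⟩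

/-! ### The weights determined by the spectra -/

theorem IsSiteWeight.commonPoints_eq {N : ℕ} {n : Fin N} {l lhat : Fin N → ℝ} {K θ : ℝ} {w : ℝ → ℝ}
    (h : IsSiteWeight n l lhat K θ w) (hθ : 0 < θ) (hθ1 : θ < 1) :
    commonPoints l lhat K = ((pointSet l).filter fun y => w y = 0).erase K := by
  ext y
  simp only [commonPoints, Finset.mem_sdiff, Finset.mem_inter, Finset.mem_singleton,
    Finset.mem_erase, Finset.mem_filter]
  constructor
  · rintro ⟨⟨h1, h2⟩, h3⟩
    exact ⟨h3, h1, ((mem_pointSet_hat_iff hθ hθ1 h.perturbed h1).1 h2).resolve_left h3⟩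
  · rintro ⟨h1, h2, h3⟩
    exact ⟨⟨h2, (mem_pointSet_hat_iff hθ hθ1 h.perturbed h2).2 (Or.inr h3)⟩, h1⟩

theorem IsSiteWeight.Nhat_commonPoints {N : ℕ} {n : Fin N} {l lhat : Fin N → ℝ} {K θ : ℝ}
    {w : ℝ → ℝ} (h : IsSiteWeight n l lhat K θ w) (hl : StrictMono l) (hlhat : StrictMono lhat)
    (hθ : 0 < θ) (hθ1 : θ < 1) : ∀ μ ∈ commonPoints l lhat K, Nhat l lhat μ = θ ^ 2 := by
  intro μ hμ
  rw [h.commonPoints_eq hθ hθ1, Finset.mem_erase, Finset.mem_filter] at hμ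
  obtain ⟨-, h1, h2⟩ := hμ
  rw [Nhat_common hl hlhat h.perturbed h1
    ((mem_pointSet_hat_iff hθ hθ1 h.perturbed h1).2 (Or.inr h2)) h2,
    h.resolvent_eq_zero μ h1 h2, mul_zero, add_zero]

theorem IsSiteWeight.isThetaSq {N : ℕ} {n : Fin N} {l lhat : Fin N → ℝ} {K θ : ℝ} {w : ℝ → ℝ}
    (h : IsSiteWeight n l lhat K θ w) (hl : StrictMono l) (hlhat : StrictMono lhat)
    (hθ : 0 < θ) (hθ1 : θ < 1) : IsThetaSq l lhat K (θ ^ 2) := by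
  refine ⟨fun hne => (h.Nhat_commonPoints hl hlhat hθ hθ1 _ (Finset.min'_mem _ hne)).symm,
    fun _ => ⟨by positivity, ?_⟩⟩
  by_cases hK : K ∈ pointSet l
  · rw [Nhat_at_K hl hlhat h.perturbed hK
      ((mem_pointSet_hat_iff hθ hθ1 h.perturbed hK).2 (Or.inl rfl))]
    have := mul_nonneg (show 0 ≤ 1 - θ ^ 2 by nlinarith) (h.nonneg K hK)
    linarith
  · exact (Nhat_of_notMem hl hlhat h.perturbed hK).ge

theorem IsSiteWeight.condition_at_K {N : ℕ} {n : Fin N} {l lhat : Fin N → ℝ} {K θ : ℝ} {w : ℝ → ℝ}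
    (h : IsSiteWeight n l lhat K θ w) (hl : StrictMono l) (hlhat : StrictMono lhat)
    (hθ : 0 < θ) (hθ1 : θ < 1) (hK : K ∈ pointSet l ∪ pointSet lhat) :
    K ∈ pointSet l ∩ pointSet lhat ∧
      (((commonPoints l lhat K).card ≤ min (n : ℕ) (N - (n : ℕ) - 1) ∧
          Nhat l lhat K > θ ^ 2) ∨
        ((commonPoints l lhat K).card < min (n : ℕ) (N - (n : ℕ) - 1) ∧
          Nhat l lhat K = θ ^ 2 ∧ deriv (Nhat l lhat) K = 0)) := by
  have hKl : K ∈ pointSet l := by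
    by_contra hc
    have hKhat := (Finset.mem_union.1 hK).resolve_left hc
    rw [← eval_rootPoly_eq_zero_iff, eval_rootPoly_hat h.perturbed hc, mul_eq_zero,
      eval_rootPoly_eq_zero_iff, quotientFun] at hKhat
    have := hKhat.resolve_left hc
    simp [hθ.ne'] at this
  have hKhat := (mem_pointSet_hat_iff hθ hθ1 h.perturbed hKl).2 (Or.inl rfl)
  have hN := Nhat_at_K hl hlhat h.perturbed hKl hKhat
  have hcard := h.card_le
  refine ⟨Finset.mem_inter.2 ⟨hKl, hKhat⟩, ?_⟩
  rw [h.commonPoints_eq hθ hθ1]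
  by_cases hw : w K = 0
  · refine Or.inr ⟨?_, by rw [hN, hw]; ring, ?_⟩
    · exact (Finset.card_erase_lt_of_mem (Finset.mem_filter.2 ⟨hKl, hw⟩)).trans_le hcard
    · rw [deriv_Nhat_at_K hl hlhat h.perturbed hKl hKhat, h.resolvent_eq_zero K hKl hw, mul_zero]
  · refine Or.inl ⟨(Finset.card_erase_le).trans hcard, ?_⟩
    have := mul_pos (show 0 < 1 - θ ^ 2 by nlinarith) ((h.nonneg K hKl).lt_of_ne' hw)
    rw [hN]
    linarith

/-- Solving the relation between the characteristic polynomials for the resolvent: it is possible as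
soon as the two polynomials match at `K`. -/
theorem exists_perturbationIdentity {N : ℕ} {l lhat : Fin N → ℝ} {K θ : ℝ}
    (hl : Function.Injective l) (hlhat : Function.Injective lhat) (hN : 0 < N) (hθ : 0 < θ)
    (hθ1 : θ < 1)
    (hK : (rootPoly (pointSet lhat)).eval K = θ ^ 2 * (rootPoly (pointSet l)).eval K) :
    ∃ w, PerturbationIdentity l lhat K θ w ∧ ∑ y ∈ pointSet l, w y = 1 := by
  have h1 : 1 - θ ^ 2 ≠ 0 := by nlinarith
  set Q := C (1 - θ ^ 2)⁻¹ * (rootPoly (pointSet lhat) - C (θ ^ 2) * rootPoly (pointSet l)) with hQ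
  have hlead : ∀ f : Fin N → ℝ, Function.Injective f → (rootPoly (pointSet f)).coeff N = 1 :=
    fun f hf => by
      have := (rootPoly_monic (pointSet f)).coeff_natDegree
      rwa [natDegree_rootPoly, card_pointSet hf] at this
  have hnd : ∀ f : Fin N → ℝ, Function.Injective f → (rootPoly (pointSet f)).natDegree ≤ N :=
    fun f hf => by rw [natDegree_rootPoly, card_pointSet hf]
  have hQd : Q.natDegree ≤ N := by
    refine (natDegree_C_mul_le _ _).trans ((natDegree_sub_le _ _).trans (max_le (hnd _ hlhat) ?_))
    exact (natDegree_C_mul_le _ _).trans (hnd _ hl)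
  have hQc : Q.coeff N = 1 := by
    rw [hQ, coeff_C_mul, coeff_sub, coeff_C_mul, hlead _ hl, hlead _ hlhat]
    field_simp
  have hQK : Q.IsRoot K := by
    rw [IsRoot.def, hQ]
    simp [hK]
  obtain ⟨R, hR⟩ := dvd_iff_isRoot.2 hQK
  have hR0 : R ≠ 0 := fun h => by rw [hR, h, mul_zero] at hQc; simp at hQc
  have hRd : R.natDegree < N := by
    rw [hR, natDegree_mul (X_sub_C_ne_zero K) hR0, natDegree_X_sub_C] at hQd
    omega
  have hRc : R.coeff (N - 1) = 1 := by
    obtain ⟨m, rfl⟩ : ∃ m, N = m + 1 := ⟨N - 1, by omega⟩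
    rw [hR, sub_mul, coeff_sub, coeff_X_mul, coeff_C_mul,
      coeff_eq_zero_of_natDegree_lt hRd, mul_zero, sub_zero] at hQc
    simpa using hQc
  obtain ⟨w, hRres⟩ : ∃ w, R = residuePoly (pointSet l) w := ⟨_, eq_residuePoly (by
    rw [card_pointSet hl, degree_eq_natDegree hR0]; exact_mod_cast hRd)⟩
  refine ⟨w, ?_, ?_⟩
  · rw [PerturbationIdentity, ← hRres, mul_assoc, ← hR, hQ, ← mul_assoc, ← C_mul,
      mul_inv_cancel₀ h1, C_1]
    ring
  · rw [← coeff_residuePoly, ← hRres, card_pointSet hl, hRc]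

/-- If every point of `lhat` lies in its slot, then in the product `P̂ (l j) / P' (l j)` all factors
except that of `lhat j` are positive, and so the weight at `l j` is nonnegative. -/
theorem weight_nonneg_of_slot {N : ℕ} {l lhat : Fin N → ℝ} {K θ : ℝ} {w : ℝ → ℝ}
    (hl : StrictMono l) (hlhat : StrictMono lhat) (hθ : 0 < θ) (hθ1 : θ < 1)
    (hp : PerturbationIdentity l lhat K θ w) (hs : ∀ i, Slot l K i (lhat i)) {j : Fin N}
    (hj : l j ≠ K) : 0 ≤ w (l j) := by
  have h1 : 0 < 1 - θ ^ 2 := by nlinarith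
  have hev := eval_rootPoly_hat_of_mem hp (mem_pointSet.2 ⟨j, rfl⟩ : l j ∈ pointSet l)
  have e1 : (rootPoly (pointSet lhat)).eval (l j) =
      (l j - lhat j) * ∏ k ∈ Finset.univ.erase j, (l j - lhat k) := by
    rw [eval_rootPoly, Finset.mul_prod_erase _ (fun k => l j - lhat k) (Finset.mem_univ j)]
    exact Finset.prod_image fun _ _ _ _ h => hlhat.injective h
  have e2 : (rootPoly ((pointSet l).erase (l j))).eval (l j) =
      ∏ k ∈ Finset.univ.erase j, (l j - l k) := by
    rw [eval_rootPoly, show (pointSet l).erase (l j) = (Finset.univ.erase j).image l by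
      rw [Finset.image_erase hl.injective, pointSet]]
    exact Finset.prod_image fun _ _ _ _ h => hl.injective h
  have hfac : ∀ k ∈ Finset.univ.erase j, 0 < (l j - lhat k) * (l j - l k) := by
    intro k hk
    have hkj := Finset.ne_of_mem_erase hk
    have hsk := hs k
    rcases lt_or_gt_of_ne hkj with hlt | hlt
    · have h2 := hl hlt
      refine mul_pos (sub_pos.2 ?_) (sub_pos.2 h2)
      rcases lt_trichotomy (l k) K with hK | hK | hK
      · exact (hsk.1 hK).2.2 j hlt
      · rw [hsk.2.1 hK, ← hK]; exact h2
      · exact (hsk.2.2 hK).1.trans_lt h2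
    · have h2 := hl hlt
      refine mul_pos_of_neg_of_neg (sub_neg.2 ?_) (sub_neg.2 h2)
      rcases lt_trichotomy (l k) K with hK | hK | hK
      · exact h2.trans_le (hsk.1 hK).1
      · rw [hsk.2.1 hK, ← hK]; exact h2
      · exact (hsk.2.2 hK).2.2 j hlt
  have hprod := Finset.prod_pos hfac
  rw [Finset.prod_mul_distrib] at hprod
  rw [e1, e2] at hev
  generalize ∏ k ∈ Finset.univ.erase j, (l j - lhat k) = A at hev hprod
  generalize ∏ k ∈ Finset.univ.erase j, (l j - l k) = B at hev hprod
  have hB : 0 < B ^ 2 := by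
    have : B ≠ 0 := right_ne_zero_of_mul hprod.ne'
    positivity
  have hmove : 0 ≤ (l j - lhat j) * (l j - K) := by
    rcases lt_or_gt_of_ne hj with hK | hK
    · exact mul_nonneg_of_nonpos_of_nonpos (sub_nonpos.2 ((hs j).1 hK).1) (sub_neg.2 hK).le
    · exact mul_nonneg (sub_nonneg.2 ((hs j).2.2 hK).1) (sub_pos.2 hK).le
  have hK2 : 0 < (l j - K) ^ 2 := by
    have := sub_ne_zero.2 hj
    positivity
  have hfin : (1 - θ ^ 2) * (l j - K) ^ 2 * B ^ 2 * w (l j) =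
      (l j - lhat j) * (l j - K) * (A * B) := by
    linear_combination -(l j - K) * B * hev
  have := mul_nonneg hmove hprod.le
  rw [← hfin] at this
  exact nonneg_of_mul_nonneg_right this (by positivity)

end JacobiInverse

theorem mainTheorem1 {N : ℕ} (n : Fin N) (l lhat : Fin N → ℝ)
    (hl : StrictMono l) (hlhat : StrictMono lhat) (K θ : ℝ) (hθ : 0 < θ) :
    (JacobiInverse.IsThetaSq l lhat K (θ ^ 2) ∧
      JacobiInverse.Interlace l lhat K ∧
      (θ ^ 2 ∈ Set.Ioo (0 : ℝ) 1 ∧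
        ∀ μ ∈ JacobiInverse.commonPoints l lhat K, JacobiInverse.Nhat l lhat μ = θ ^ 2) ∧
      (K ∉ JacobiInverse.pointSet l ∪ JacobiInverse.pointSet lhat →
        (JacobiInverse.commonPoints l lhat K).card ≤ min (n : ℕ) (N - (n : ℕ) - 1) ∧
          JacobiInverse.Nhat l lhat K = θ ^ 2) ∧
      (K ∈ JacobiInverse.pointSet l ∪ JacobiInverse.pointSet lhat →
        K ∈ JacobiInverse.pointSet l ∩ JacobiInverse.pointSet lhat ∧
          (((JacobiInverse.commonPoints l lhat K).card ≤ min (n : ℕ) (N - (n : ℕ) - 1) ∧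
              JacobiInverse.Nhat l lhat K > θ ^ 2) ∨
            ((JacobiInverse.commonPoints l lhat K).card < min (n : ℕ) (N - (n : ℕ) - 1) ∧
              JacobiInverse.Nhat l lhat K = θ ^ 2 ∧
              deriv (JacobiInverse.Nhat l lhat) K = 0)))) ↔
    (θ < 1 ∧ ∃ J Jt : Matrix (Fin N) (Fin N) ℝ,
      JacobiInverse.IsJacobi J ∧ JacobiInverse.IsJacobi Jt ∧
      Jt = JacobiInverse.massSpringPerturbation J n θ (((θ ^ 2)⁻¹ - 1) * K) ∧
      spectrum ℝ J = Set.range l ∧ spectrum ℝ Jt = Set.range lhat) := by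
  open JacobiInverse in
  constructor
  · rintro ⟨-, hI, ⟨hθI, hII⟩, hIII, hIV⟩
    have hθ1 : θ < 1 := by
      have := hθI.2
      nlinarith
    have h1 : 0 < 1 - θ ^ 2 := by nlinarith
    refine ⟨hθ1, ?_⟩
    have hKhat : K ∈ pointSet l → K ∈ pointSet lhat := fun h =>
      (Finset.mem_inter.1 (hIV (Finset.mem_union_left _ h)).1).2
    have hKev : (Polynomial.eval K (rootPoly (pointSet lhat))) =
        θ ^ 2 * Polynomial.eval K (rootPoly (pointSet l)) := by
      by_cases hK : K ∈ pointSet l ∪ pointSet lhat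
      · obtain ⟨h2, h3⟩ := Finset.mem_inter.1 (hIV hK).1
        rw [eval_rootPoly_eq_zero_iff.2 h2, eval_rootPoly_eq_zero_iff.2 h3, mul_zero]
      · have hN := (hIII hK).2
        rw [Finset.mem_union, not_or] at hK
        have hP : Polynomial.eval K (rootPoly (pointSet l)) ≠ 0 := fun h =>
          hK.1 (eval_rootPoly_eq_zero_iff.1 h)
        have e : ∀ f : Fin N → ℝ, StrictMono f →
            ∏ j, (K - f j) = Polynomial.eval K (rootPoly (pointSet f)) := fun f hf => by
          rw [eval_rootPoly]
          exact (Finset.prod_image fun _ _ _ _ h => hf.injective h).symm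
        rw [Nhat_eq_div hl hlhat fun j h => hK.1 (mem_pointSet.2 ⟨j, h.symm⟩), e l hl, e lhat hlhat,
          div_eq_iff hP] at hN
        exact hN
    obtain ⟨w, hp, hsum⟩ := exists_perturbationIdentity hl.injective hlhat.injective n.pos hθ hθ1 hKev
    have hslot := slot_of_interlace hl hlhat hI hKhat
    have hNK : K ∈ pointSet l → Nhat l lhat K = θ ^ 2 + (1 - θ ^ 2) * w K := fun h =>
      Nhat_at_K hl hlhat hp h (hKhat h)
    have hcommon : ∀ y ∈ pointSet l, y ≠ K → w y = 0 → y ∈ commonPoints l lhat K :=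
      fun y hy hyK hw => Finset.mem_sdiff.2 ⟨Finset.mem_inter.2
        ⟨hy, (mem_pointSet_hat_iff hθ hθ1 hp hy).2 (Or.inr hw)⟩, by simpa using hyK⟩
    have hsubset : ((pointSet l).filter fun y => w y = 0).erase K ⊆ commonPoints l lhat K :=
      fun y hy => by
        obtain ⟨h2, h3⟩ := Finset.mem_erase.1 hy
        exact hcommon y (Finset.mem_filter.1 h3).1 h2 (Finset.mem_filter.1 h3).2
    -- A zero weight at `K` excludes the strict inequality in the condition at `K`.
    have hKzero : K ∈ pointSet l → w K = 0 →
        (commonPoints l lhat K).card < min (n : ℕ) (N - (n : ℕ) - 1) ∧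
          deriv (Nhat l lhat) K = 0 := fun hK hw => by
      rcases (hIV (Finset.mem_union_left _ hK)).2 with h | h
      · have := h.2
        rw [hNK hK, hw, mul_zero, add_zero] at this
        exact absurd this (lt_irrefl _)
      · exact ⟨h.1, h.2.2⟩
    have hcardle : (commonPoints l lhat K).card ≤ min (n : ℕ) (N - (n : ℕ) - 1) := by
      by_cases hK : K ∈ pointSet l ∪ pointSet lhat
      · exact (hIV hK).2.elim (fun h => h.1) fun h => h.1.le
      · exact (hIII hK).1
    refine IsSiteWeight.exists_jacobi (w := w) ⟨fun y hy => ?_, hsum, hp, ?_, fun y hy hw => ?_⟩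
      hl hlhat hθ
    · obtain ⟨j, rfl⟩ := mem_pointSet.1 hy
      by_cases hj : l j = K
      · rw [hj] at hy ⊢
        have h2 : θ ^ 2 ≤ Nhat l lhat K := by
          rcases (hIV (Finset.mem_union_left _ hy)).2 with h | h
          · exact h.2.le
          · exact h.2.1.ge
        rw [hNK hy] at h2
        exact nonneg_of_mul_nonneg_right (show 0 ≤ (1 - θ ^ 2) * w K by linarith) h1
      · exact weight_nonneg_of_slot hl hlhat hθ hθ1 hp hslot hj
    · have hcard := Finset.card_le_card hsubset
      by_cases hK : K ∈ (pointSet l).filter fun y => w y = 0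
      · rw [Finset.card_erase_of_mem hK] at hcard
        have := (hKzero (Finset.mem_filter.1 hK).1 (Finset.mem_filter.1 hK).2).1
        omega
      · rw [Finset.erase_eq_of_notMem hK] at hcard
        exact hcard.trans hcardle
    · by_cases hyK : y = K
      · subst hyK
        have h2 := (hKzero hy hw).2
        rw [deriv_Nhat_at_K hl hlhat hp hy (hKhat hy)] at h2
        exact (mul_eq_zero.1 h2).resolve_left h1.ne'
      · have h2 := hII y (hcommon y hy hyK hw)
        rw [Nhat_common hl hlhat hp hy ((mem_pointSet_hat_iff hθ hθ1 hp hy).2 (Or.inr hw)) hw,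
          add_eq_left] at h2
        exact (mul_eq_zero.1 h2).resolve_left (mul_ne_zero h1.ne' (sub_ne_zero.2 hyK))
  · rintro ⟨hθ1, J, _, hJ, -, rfl, hs, hst⟩
    obtain ⟨w, h⟩ := exists_isSiteWeight hl hlhat hθ hJ hs hst
    refine ⟨h.isThetaSq hl hlhat hθ hθ1, interlace_of_slot hl (h.slot hl hlhat hθ hθ1),
      ⟨⟨by positivity, by nlinarith⟩, h.Nhat_commonPoints hl hlhat hθ hθ1⟩, fun hK => ⟨?_, ?_⟩,
      h.condition_at_K hl hlhat hθ hθ1⟩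
    · rw [h.commonPoints_eq hθ hθ1]
      exact Finset.card_erase_le.trans h.card_le
    · exact Nhat_of_notMem hl hlhat h.perturbed fun hc => hK (Finset.mem_union_left _ hc)
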